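/- All graphs are finite and simple. A star $k$-edge coloring of a graph $G$ is a proper edge coloring of $G$ with colors from $\{1,\dots,k\}$ such that no path and no cycle with four edges is bi-colored (uses only two colors); the star chromatic index $\chi'_{st}(G)$ is the smallest $k$ for which $G$ has a star $k$-edge coloring. A cubic Halin graph $G=T\cup C$ is a plane graph consisting of a plane embedding of a tree $T$, in which every vertex that is not a leaf has degree exactly $3$, and a cycle $C$ passing through exactly the leaves of $T$ such that $C$ is the boundary of the exterior face; $T$ is called the characteristic tree of $G$. A caterpillar is a tree such that the removal of all its leaves results in a path. Let $\mathcal{G}_h$ be the set of all cubic Halin graphs whose characteristic trees are caterpillars with $h+2$ leaves. Let $N_{e_2}$ be the graph with vertices $v_1,v_2,u_0,u_1,u_2,u_3$ and edges $v_1v_2$, $v_1u_0$, $v_1u_1$, $v_2u_2$, $v_2u_3$, $u_0u_1$, $u_1u_2$, $u_2u_3$, $u_3u_0$ (the triangular prism). **Theorem.** Let $h$ be a positive integer and let $G=T\cup C\in\mathcal{G}_h$. If $G$ is not isomorphic to $N_{e_2}$, then $\chi'_{st}(G)=5$. -/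

import Mathlib

namespace HalinStar

variable {V : Type*}

/-! ### Star edge colorings -/

/-- Along the walk `p`, the edge coloring `c` uses no color outside some pair `{a, b}`.
(For a proper coloring and a walk containing two adjacent edges this means exactly two colors.) -/
def IsBicolored {G : SimpleGraph V} {k : ℕ} (c : G.edgeSet → Fin k) {u v : V}
    (p : G.Walk u v) : Prop :=
  ∃ a b : Fin k, ∀ e : G.edgeSet, (e : Sym2 V) ∈ p.edges → c e = a ∨ c e = b

/-- A proper edge coloring (a vertex coloring of the line graph) is a star edge coloring if no path
and no cycle with four edges is bicolored. -/
def IsStarEdgeColoring {G : SimpleGraph V} {k : ℕ} (c : G.lineGraph.Coloring (Fin k)) : Prop :=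
  (∀ (u v : V) (p : G.Walk u v), p.IsPath → p.length = 4 → ¬ IsBicolored (fun e => c e) p) ∧
  (∀ (u : V) (p : G.Walk u u), p.IsCycle → p.length = 4 → ¬ IsBicolored (fun e => c e) p)

/-- The graph has a star edge coloring with colors from a set of size `k`. -/
def StarEdgeColorable (G : SimpleGraph V) (k : ℕ) : Prop :=
  ∃ c : G.lineGraph.Coloring (Fin k), IsStarEdgeColoring c

/-- The star chromatic index: the least `k` such that a star `k`-edge coloring exists (one always
exists for a finite graph; the value `5` is never the default value of `sInf`). -/
noncomputable def starChromaticIndex (G : SimpleGraph V) : ℕ :=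
  sInf {k : ℕ | StarEdgeColorable G k}

/-! ### Plane embeddings, given combinatorially by rotation systems of genus zero -/

/-- A rotation system: for every vertex a cyclic order of the darts (oriented edges) leaving it. -/
structure RotationSystem (G : SimpleGraph V) where
  /-- the next dart around the same vertex -/
  rot : Equiv.Perm G.Dart
  rot_fst : ∀ d, (rot d).fst = d.fst
  cyclic : ∀ d d' : G.Dart, d.fst = d'.fst → rot.SameCycle d d'

/-- The face permutation: walk along the dart `d`, then leave its end by the dart which follows the
reversal of `d` in the rotation. Its cycles are the facial walks. -/
def RotationSystem.faceMap {G : SimpleGraph V} (R : RotationSystem G) : Equiv.Perm G.Dart :=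
  R.rot * Function.Involutive.toPerm SimpleGraph.Dart.symm SimpleGraph.Dart.symm_involutive

/-- The faces of the embedding: the cycles of the face permutation. -/
def RotationSystem.Face {G : SimpleGraph V} (R : RotationSystem G) : Type _ :=
  Quotient (Equiv.Perm.SameCycle.setoid R.faceMap)

/-- The rotation system of a connected finite graph with at least one edge describes an embedding in
the plane (equivalently the sphere): its Euler characteristic `|V| - |E| + |F|` is two. -/
def RotationSystem.IsPlane {G : SimpleGraph V} (R : RotationSystem G) : Prop :=
  G.Connected ∧ Nat.card V + Nat.card R.Face = G.edgeSet.ncard + 2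

/-! ### Halin graphs -/

/-- The degree of `v` in `T`. -/
noncomputable def deg (T : SimpleGraph V) (v : V) : ℕ := (T.neighborSet v).ncard

/-- `G = T ∪ C` is a Halin graph with characteristic tree `T` and cycle `C`: `T` is a tree without
vertices of degree two, `C` is a cycle through exactly the leaves of `T`, and `G` has a plane
embedding one of whose facial walks is `C`. (Any face of an embedding in the sphere may be taken as
the exterior face.) -/
structure IsHalin (G T : SimpleGraph V) {r : V} (C : G.Walk r r) : Prop where
  isTree : T.IsTree
  deg_ne_two : ∀ v, deg T v ≠ 2
  isCycle : C.IsCycle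
  mem_cycle : ∀ v, v ∈ C.support ↔ deg T v = 1
  union : ∀ e, e ∈ G.edgeSet ↔ e ∈ T.edgeSet ∨ e ∈ C.edges
  plane : ∃ R : RotationSystem G, R.IsPlane ∧
    ∃ d₀ : G.Dart, ∀ d : G.Dart, d ∈ C.darts ↔ R.faceMap.SameCycle d₀ d

/-- `G = T ∪ C` is a cubic Halin graph: every non-leaf of `T` has degree three in `T`. -/
structure IsCubicHalin (G T : SimpleGraph V) {r : V} (C : G.Walk r r) : Prop where
  isHalin : IsHalin G T C
  deg_eq_three : ∀ v, deg T v ≠ 1 → deg T v = 3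

/-- A caterpillar: a tree such that removing all its leaves results in a path. -/
def IsCaterpillar (T : SimpleGraph V) : Prop :=
  T.IsTree ∧ ∃ n : ℕ, Nonempty (T.induce {v | deg T v ≠ 1} ≃g SimpleGraph.pathGraph n)

/-- The class `𝒢_h` of cubic Halin graphs whose characteristic tree is a caterpillar with `h + 2`
leaves. -/
def CaterpillarHalin (h : ℕ) (G : SimpleGraph V) : Prop :=
  ∃ (T : SimpleGraph V) (r : V) (C : G.Walk r r),
    IsCubicHalin G T C ∧ IsCaterpillar T ∧ {v | deg T v = 1}.ncard = h + 2

/-- The necklace `N_{e_h}` (`h ≥ 1`): a spine `v₁ … v_h` (`Sum.inl i` is `v_{i+1}`), a cycle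
`u₀ u₁ … u_{h+1} u₀` (`Sum.inr k` is `u_k`), the edges `v_i u_i` for `1 ≤ i ≤ h`, and the two further
edges `v₁ u₀` and `v_h u_{h+1}`. -/
def necklace (h : ℕ) : SimpleGraph (Fin h ⊕ Fin (h + 2)) :=
  SimpleGraph.fromRel fun x y => match x, y with
    | .inl i, .inl j => i.val + 1 = j.val
    | .inl i, .inr k => k.val = i.val + 1 ∨ (i.val = 0 ∧ k.val = 0) ∨
        (i.val + 1 = h ∧ k.val = h + 1)
    | .inr k, .inr l => k.val + 1 = l.val ∨ (k.val = h + 1 ∧ l.val = 0)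
    | .inr _, .inl _ => False

end HalinStar

/-! Lower bound. With four colors, each vertex of a cubic graph misses exactly one color. Among the
three neighbors of `v`, draw an arrow from `x` to `y` if `x` misses the color of `vy`. The star
condition forces an arrow between any two of them, and each sends at most one, so every pair carries
exactly one arrow. In a triangle this says that of any two corners exactly one misses the color of
its opposite edge, which is impossible for three corners (`not_starEdgeColorable_of_triangle`). The
graphs in question are cubic and have a triangle at the end of the spine.

Upper bound. The graph consists of three strands with common ends: the spine, prolonged by a leaf at
each end (the poles), and two rails; each inner spine vertex is joined by a rung to a leaf on one of
the rails. The edges are colored from left to right, and all that matters at a cut is a `Front`. Up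
to renaming colors and exchanging rails, five fronts suffice: wherever the next rung lies, each can
be advanced to one of the five (`keyMove_spec`), and each can be completed over any last three rungs
(`completes_keyFront_of_length_eq_three`). One rung is done by hand, and two rungs give the excluded
prism.

Planarity is what shows that the cycle runs along the rails. By Euler's formula there are `|C| + 1`
faces. Every face other than the exterior one contains a reversed dart of `C`, hence exactly one
(`IsHalin.eq_of_sameCycle_symm`). So a facial walk that enters the tree at one leaf and leaves it at
another identifies consecutive leaves of `C`, and tracing such walks along the spine gives
`IsHalin.exists_rimStep_rails`. -/

namespace HalinStar
variable {V : Type*}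

/-! ### Star edge colorings as a local condition -/

/-- A symmetric edge coloring, given together with a palette at every vertex, is a star edge coloring
as soon as a local condition holds at the middle vertex of each path with four edges. -/
theorem starEdgeColorable_of_local {G : SimpleGraph V} {k : ℕ} (c : V → V → Fin k)
    (pal : V → Finset (Fin k)) (symm : ∀ x y, c x y = c y x)
    (mem : ∀ x y, G.Adj x y → c x y ∈ pal x)
    (loc : ∀ v x y, G.Adj v x → G.Adj v y → x ≠ y →
      c v x ≠ c v y ∧ ¬ (c v y ∈ pal x ∧ c v x ∈ pal y)) :
    StarEdgeColorable G k := by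
  let f : Sym2 V → Fin k := Sym2.lift ⟨c, symm⟩
  -- The case `p₀ = p₄` is allowed, so this covers paths and cycles alike. In a bicolored walk each
  -- outer edge repeats the color of the inner edge on the other side of `p₂`, which is what `loc`
  -- forbids there.
  have key : ∀ p₀ p₁ p₂ p₃ p₄ : V, G.Adj p₀ p₁ → G.Adj p₁ p₂ → G.Adj p₂ p₃ → G.Adj p₃ p₄ →
      p₀ ≠ p₂ → p₁ ≠ p₃ → p₂ ≠ p₄ → ∀ a b : Fin k,
      (c p₀ p₁ = a ∨ c p₀ p₁ = b) → (c p₁ p₂ = a ∨ c p₁ p₂ = b) →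
      (c p₂ p₃ = a ∨ c p₂ p₃ = b) → (c p₃ p₄ = a ∨ c p₃ p₄ = b) → False := by
    intro p₀ p₁ p₂ p₃ p₄ h₁ h₂ h₃ h₄ n₁ n₂ n₃ a b c₁ c₂ c₃ c₄
    have e₁ := (loc p₁ p₀ p₂ h₁.symm h₂ n₁).1
    have e₂ := loc p₂ p₁ p₃ h₂.symm h₃ n₂
    have e₃ := (loc p₃ p₂ p₄ h₃.symm h₄ n₃).1
    have m₁ := mem p₁ p₀ h₁.symm
    have m₃ := mem p₃ p₄ h₄
    rw [symm p₁ p₀] at e₁ m₁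
    rw [symm p₂ p₁] at e₂
    rw [symm p₃ p₂] at e₃
    grind
  refine ⟨SimpleGraph.Coloring.mk (fun e => f e) ?_, ?_, ?_⟩
  · rintro ⟨e, he⟩ ⟨e', he'⟩ hadj
    rw [SimpleGraph.lineGraph_adj_iff_exists] at hadj
    obtain ⟨hne, v, hv, hv'⟩ := hadj
    obtain ⟨x, rfl⟩ := hv
    obtain ⟨y, rfl⟩ := hv'
    rw [SimpleGraph.mem_edgeSet] at he he'
    have hxy : x ≠ y := fun h => hne (by subst h; rfl)
    exact (loc v x y he he' hxy).1
  · intro u v p hp hl ⟨a, b, hab⟩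
    match p, hp, hl, hab with
    | .cons (v := p₁) h₁ (.cons (v := p₂) h₂ (.cons (v := p₃) h₃ (.cons h₄ .nil))), hp, _, hab =>
      have c₁ := hab ⟨s(_, _), h₁⟩ (by simp)
      have c₂ := hab ⟨s(_, _), h₂⟩ (by simp)
      have c₃ := hab ⟨s(_, _), h₃⟩ (by simp)
      have c₄ := hab ⟨s(_, _), h₄⟩ (by simp)
      simp only [SimpleGraph.Walk.isPath_def, SimpleGraph.Walk.support_cons,
        SimpleGraph.Walk.support_nil, List.nodup_cons, List.mem_cons, not_or] at hp
      exact key _ _ _ _ _ h₁ h₂ h₃ h₄ hp.1.2.1 hp.2.1.2.1 hp.2.2.1.2.1 a b c₁ c₂ c₃ c₄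
  · intro u p hp hl ⟨a, b, hab⟩
    match p, hp, hl, hab with
    | .cons (v := p₁) h₁ (.cons (v := p₂) h₂ (.cons (v := p₃) h₃ (.cons h₄ .nil))), hp, _, hab =>
      have c₁ := hab ⟨s(_, _), h₁⟩ (by simp)
      have c₂ := hab ⟨s(_, _), h₂⟩ (by simp)
      have c₃ := hab ⟨s(_, _), h₃⟩ (by simp)
      have c₄ := hab ⟨s(_, _), h₄⟩ (by simp)
      have hn := hp.support_nodup
      simp only [SimpleGraph.Walk.support_cons, List.tail_cons,
        SimpleGraph.Walk.support_nil, List.nodup_cons, List.mem_cons, not_or] at hn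
      exact key _ _ _ _ _ h₁ h₂ h₃ h₄ (Ne.symm hn.2.1.2.1) hn.1.2.1 hn.2.1.2.1 a b c₁ c₂ c₃ c₄

/-- A star edge coloring as a function of two vertices. -/
theorem StarEdgeColorable.exists_local {G : SimpleGraph V} {k l : ℕ} [NeZero l] (hkl : k ≤ l)
    (h : StarEdgeColorable G k) :
    ∃ d : V → V → Fin l, (∀ x y, d x y = d y x) ∧
      (∀ v x y, G.Adj v x → G.Adj v y → x ≠ y → d v x ≠ d v y) ∧
      (∀ p₀ p₁ p₂ p₃ p₄ : V, G.Adj p₀ p₁ → G.Adj p₁ p₂ → G.Adj p₂ p₃ → G.Adj p₃ p₄ →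
        p₀ ≠ p₂ → p₁ ≠ p₃ → p₂ ≠ p₄ → d p₀ p₁ = d p₂ p₃ → d p₁ p₂ ≠ d p₃ p₄) := by
  classical
  obtain ⟨c, hc₁, hc₂⟩ := h
  let f : Sym2 V → Fin l := fun e => if h : e ∈ G.edgeSet then Fin.castLE hkl (c ⟨e, h⟩) else 0
  have hf : ∀ e (h : e ∈ G.edgeSet), f e = Fin.castLE hkl (c ⟨e, h⟩) := fun e h => dif_pos h
  have hinj := Fin.castLE_injective hkl
  have hfc : ∀ e e' (h : e ∈ G.edgeSet) (h' : e' ∈ G.edgeSet), f e = f e' →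
      c ⟨e, h⟩ = c ⟨e', h'⟩ := by
    intro e e' h h' hee
    rw [hf e h, hf e' h'] at hee
    exact hinj hee
  have proper : ∀ v x y, G.Adj v x → G.Adj v y → x ≠ y → f s(v, x) ≠ f s(v, y) := by
    intro v x y hx hy hxy heq
    refine c.valid (v := ⟨s(v, x), hx⟩) (w := ⟨s(v, y), hy⟩) ?_ (hfc _ _ hx hy heq)
    rw [SimpleGraph.lineGraph_adj_iff_exists]
    refine ⟨?_, v, Sym2.mem_mk_left _ _, Sym2.mem_mk_left _ _⟩
    simp only [ne_eq, Subtype.ext_iff, Sym2.congr_right]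
    exact hxy
  refine ⟨fun x y => f s(x, y), fun x y => congrArg f Sym2.eq_swap, proper, ?_⟩
  intro p₀ p₁ p₂ p₃ p₄ h₁ h₂ h₃ h₄ n₁ n₂ n₃ e₁ e₂
  have e₁' := hfc _ _ h₁ h₃ e₁
  have e₂' := hfc _ _ h₂ h₄ e₂
  -- If `p₀ = p₃`, the first and third edges have the same color and a common end. Likewise `p₁ ≠
  -- p₄`, so the walk is a path unless `p₀ = p₄`, when it is a 4-cycle.
  have n₀₃ : p₀ ≠ p₃ := by
    rintro rfl
    refine proper p₀ p₁ p₂ h₁ h₃.symm h₂.ne ?_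
    exact e₁.trans (congrArg f Sym2.eq_swap)
  have n₁₄ : p₁ ≠ p₄ := by
    rintro rfl
    refine proper p₁ p₂ p₃ h₂ h₄.symm h₃.ne ?_
    exact e₂.trans (congrArg f Sym2.eq_swap)
  have bic : ∀ e : G.edgeSet, (e : Sym2 V) ∈ [s(p₀, p₁), s(p₁, p₂), s(p₂, p₃), s(p₃, p₄)] →
      c e = c ⟨s(p₀, p₁), h₁⟩ ∨ c e = c ⟨s(p₁, p₂), h₂⟩ := by
    rintro ⟨e, he⟩ hmem
    simp only [List.mem_cons, List.not_mem_nil, or_false] at hmem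
    rcases hmem with rfl | rfl | rfl | rfl
    · exact .inl rfl
    · exact .inr rfl
    · exact .inl e₁'.symm
    · exact .inr e₂'.symm
  have := h₁.ne; have := h₂.ne; have := h₃.ne; have := h₄.ne
  by_cases h₀₄ : p₀ = p₄
  · subst h₀₄
    refine hc₂ p₀ (.cons h₁ (.cons h₂ (.cons h₃ (.cons h₄ .nil)))) ?_ rfl
      ⟨c ⟨s(p₀, p₁), h₁⟩, c ⟨s(p₁, p₂), h₂⟩, by simpa using bic⟩
    rw [SimpleGraph.Walk.cons_isCycle_iff]
    simp only [SimpleGraph.Walk.isPath_def, SimpleGraph.Walk.support_cons,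
      SimpleGraph.Walk.support_nil, SimpleGraph.Walk.edges_cons, SimpleGraph.Walk.edges_nil]
    grind
  · refine hc₁ p₀ p₄ (.cons h₁ (.cons h₂ (.cons h₃ (.cons h₄ .nil)))) ?_ rfl
      ⟨c ⟨s(p₀, p₁), h₁⟩, c ⟨s(p₁, p₂), h₂⟩, by simpa using bic⟩
    simp only [SimpleGraph.Walk.isPath_def, SimpleGraph.Walk.support_cons,
      SimpleGraph.Walk.support_nil]
    grind

/-! ### Lower bound: four colors fail on a cubic graph with a triangle -/

/-- Every vertex has exactly three neighbors. -/
def IsCubic (G : SimpleGraph V) : Prop :=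
  ∀ v, ∃ x y z, x ≠ y ∧ x ≠ z ∧ y ≠ z ∧ ∀ u, G.Adj v u ↔ u = x ∨ u = y ∨ u = z

theorem exists_missing_color : ∀ a b c : Fin 4, a ≠ b → a ≠ c → b ≠ c →
    ∃ m, ∀ e, e ≠ m ↔ e = a ∨ e = b ∨ e = c := by decide

theorem exists_third_of_triple {a b c x y : V} (hab : a ≠ b) (hac : a ≠ c) (hbc : b ≠ c)
    (hx : x = a ∨ x = b ∨ x = c) (hy : y = a ∨ y = b ∨ y = c) (hxy : x ≠ y) :
    ∃ z, x ≠ z ∧ y ≠ z ∧ ∀ u, (u = a ∨ u = b ∨ u = c) ↔ (u = x ∨ u = y ∨ u = z) := by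
  rcases hx with rfl | rfl | rfl <;> rcases hy with rfl | rfl | rfl
  · exact absurd rfl hxy
  · exact ⟨c, hac, hbc, by grind⟩
  · exact ⟨b, hab, by grind, by grind⟩
  · exact ⟨c, by grind, by grind, by grind⟩
  · exact absurd rfl hxy
  · exact ⟨a, by grind, by grind, by grind⟩
  · exact ⟨b, by grind, by grind, by grind⟩
  · exact ⟨a, by grind, by grind, by grind⟩
  · exact absurd rfl hxy

theorem IsCubic.exists_third {G : SimpleGraph V} (hG : IsCubic G) {v x y : V} (hx : G.Adj v x)
    (hy : G.Adj v y) (hxy : x ≠ y) :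
    ∃ z, x ≠ z ∧ y ≠ z ∧ ∀ u, G.Adj v u ↔ u = x ∨ u = y ∨ u = z := by
  obtain ⟨a, b, c, hab, hac, hbc, h⟩ := hG v
  obtain ⟨z, h₃, h₄, h₅⟩ := exists_third_of_triple hab hac hbc ((h x).1 hx) ((h y).1 hy) hxy
  exact ⟨z, h₃, h₄, fun u => (h u).trans (h₅ u)⟩

/-- A cubic graph containing a triangle has no star edge coloring with four colors. -/
theorem not_starEdgeColorable_of_triangle {G : SimpleGraph V} (hG : IsCubic G) {v u w : V}
    (hvu : G.Adj v u) (hvw : G.Adj v w) (huw : G.Adj u w) {k : ℕ} (hk : k ≤ 4) :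
    ¬ StarEdgeColorable G k := by
  intro hcol
  obtain ⟨d, symm, proper, star⟩ := hcol.exists_local hk
  have hm : ∀ v, ∃ m, ∀ e, e ≠ m ↔ ∃ x, G.Adj v x ∧ d v x = e := by
    intro v
    obtain ⟨x, y, z, hxy, hxz, hyz, h⟩ := hG v
    have hx := (h x).2 (.inl rfl)
    have hy := (h y).2 (.inr (.inl rfl))
    have hz := (h z).2 (.inr (.inr rfl))
    obtain ⟨m, hm⟩ := exists_missing_color _ _ _ (proper v x y hx hy hxy)
      (proper v x z hx hz hxz) (proper v y z hy hz hyz)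
    refine ⟨m, fun e => (hm e).trans ⟨?_, ?_⟩⟩
    · rintro (rfl | rfl | rfl)
      exacts [⟨x, hx, rfl⟩, ⟨y, hy, rfl⟩, ⟨z, hz, rfl⟩]
    · rintro ⟨q, hq, rfl⟩
      rcases (h q).1 hq with rfl | rfl | rfl <;> simp
  choose m hm using hm
  have hne : ∀ v x, G.Adj v x → d v x ≠ m v := fun v x h => (hm v _).2 ⟨x, h, rfl⟩
  have loc : ∀ v x y, G.Adj v x → G.Adj v y → x ≠ y → d v y = m x ∨ d v x = m y := by
    intro v x y hx hy hxy
    by_contra! hcon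
    obtain ⟨a, ha, ha'⟩ := (hm x _).1 hcon.1
    obtain ⟨b, hb, hb'⟩ := (hm y _).1 hcon.2
    refine star a x v y b ha.symm hx.symm hy hb ?_ hxy ?_ ?_ ?_
    · rintro rfl
      exact proper a x y hx hy hxy (by rw [symm a x, ha'])
    · rintro rfl
      exact proper v y x hy hx hxy.symm (by rw [symm v y, hb'])
    · rw [symm, ha']
    · rw [symm x v, hb']
  -- Three pairs of neighbors each need an arrow (by `loc`), and each of the three missing colors
  -- can serve only one pair; hence each pair is served exactly once.
  have tri : ∀ v x y, G.Adj v x → G.Adj v y → x ≠ y →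
      (m x = d v y ∧ m y ≠ d v x) ∨ (m y = d v x ∧ m x ≠ d v y) := by
    intro v x y hx hy hxy
    obtain ⟨z, hxz, hyz, h⟩ := hG.exists_third hx hy hxy
    have hz := (h z).2 (.inr (.inr rfl))
    have l₁ := loc v x y hx hy hxy
    have l₂ := loc v x z hx hz hxz
    have l₃ := loc v y z hy hz hyz
    have := proper v x y hx hy hxy
    have := proper v x z hx hz hxz
    have := proper v y z hy hz hyz
    grind
  -- Parity: "the corner misses the color of the opposite edge" would hold for exactly one of any
  -- two of the three corners.
  have t₁ := tri v u w hvu hvw huw.ne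
  have t₂ := tri u v w hvu.symm huw hvw.ne
  have t₃ := tri w v u hvw.symm huw.symm hvu.ne
  have := symm u v; have := symm w v; have := symm w u
  have := hne v u hvu; have := hne v w hvw
  have := hne u v hvu.symm; have := hne u w huw
  have := hne w u huw.symm; have := hne w v hvw.symm
  have := proper v u w hvu hvw huw.ne
  have := proper u v w hvu.symm huw hvw.ne
  have := proper w v u hvw.symm huw.symm hvu.ne
  grind

end HalinStar

/-! ### Upper bound: coloring three strands from left to right -/

namespace HalinStar

/-- A strand cut open to the right of one of its vertices: the color of the cut edge, the colors at its
left end, and the colors which may not occur at its right end. -/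
structure Strand where
  col : Fin 5
  pal : Finset (Fin 5)
  forb : Finset (Fin 5)

/-- The three strands at a cut: the spine `none` and the two rails `some b`. -/
abbrev Front := Option Bool → Strand

/-- The front with the given rails and spine. -/
def frontOf (s₀ s₁ s : Strand) : Front
  | some false => s₀
  | some true => s₁
  | none => s

/-- The strand behind its next vertex, which has a rung of color `r` to a vertex with palette `p`, when
the next edge gets the color `x`. -/
def Strand.next (t : Strand) (r x : Fin 5) (p : Finset (Fin 5)) : Strand :=
  ⟨x, {t.col, r, x}, (if x ∈ t.pal then {t.col} else ∅) ∪ (if x ∈ p then {r} else ∅)⟩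

/-- The colors chosen at the next vertex of the strand are admissible. -/
def Strand.Extends (t : Strand) (r x : Fin 5) (p : Finset (Fin 5)) : Prop :=
  t.col ≠ r ∧ t.col ≠ x ∧ r ≠ x ∧ (t.col ∉ t.forb ∧ r ∉ t.forb ∧ x ∉ t.forb) ∧
    ¬ (r ∈ t.pal ∧ t.col ∈ p)

instance (t : Strand) (r x : Fin 5) (p : Finset (Fin 5)) : Decidable (t.Extends r x p) := by
  unfold Strand.Extends; infer_instance

/-- The front behind the next rung, which joins the spine to the rail `b`. -/
def Front.advance (f : Front) (b : Bool) (r x y : Fin 5) : Front := fun σ =>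
  if σ = none then (f none).next r y {(f (some b)).col, r, x}
  else if σ = some b then (f (some b)).next r x {(f none).col, r, y}
  else f σ

/-- The colors of the next rung and of the two edges behind it are admissible. -/
def Front.Advances (f : Front) (b : Bool) (r x y : Fin 5) : Prop :=
  (f none).Extends r y {(f (some b)).col, r, x} ∧ (f (some b)).Extends r x {(f none).col, r, y}

instance (f : Front) (b : Bool) (r x y : Fin 5) : Decidable (f.Advances b r x y) := by
  unfold Front.Advances; infer_instance

/-- The three strands may end in a common vertex. -/
def Front.Closes (f : Front) : Prop :=
  ∀ σ τ, (f τ).col ∉ (f σ).forb ∧ (σ ≠ τ → (f σ).col ≠ (f τ).col ∧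
    ¬ ((f σ).col ∈ (f τ).pal ∧ (f τ).col ∈ (f σ).pal))

instance (f : Front) : Decidable f.Closes := by
  unfold Front.Closes; infer_instance

/-- The coloring can be completed when the remaining rungs are on the given sides. -/
def Completes : List Bool → Front → Prop
  | [], f => f.Closes
  | b :: l, f => ∃ r x y, f.Advances b r x y ∧ Completes l (f.advance b r x y)

/-- The front `f` is at least as permissive as the front `g`, with the colors renamed by `π` and, if `e` is
true, the rails exchanged. -/
def Simulates (π : Fin 5 → Fin 5) (e : Bool) (f g : Front) : Prop :=
  ∀ σ, (f σ).col = π (g (σ.map (xor e))).col ∧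
    ∀ a, (π a ∈ (f σ).pal ↔ a ∈ (g (σ.map (xor e))).pal) ∧
      (π a ∈ (f σ).forb → a ∈ (g (σ.map (xor e))).forb)

instance (π : Fin 5 → Fin 5) (e : Bool) (f g : Front) : Decidable (Simulates π e f g) := by
  unfold Simulates; infer_instance

/-- The new palettes and forbidden sets on the two advanced strands depend only on colors and
palettes, which correspond under `π`; the other rail is unchanged. -/
theorem Simulates.advance {π : Fin 5 → Fin 5} (hπ : Function.Injective π) {e : Bool} {f g : Front}
    (h : Simulates π e f g) (b : Bool) (r x y : Fin 5) :
    Simulates π e (f.advance b (π r) (π x) (π y)) (g.advance (xor e b) r x y) := by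
  have hn := h none
  have hb := h (some b)
  simp only [Option.map_none, Option.map_some] at hn hb
  rintro (_ | d)
  · simp only [Front.advance, Option.map_none, if_true, Strand.next, hn.1, hb.1, true_and]
    intro a
    constructor
    · simp [hπ.eq_iff]
    · simp only [hn.2, Finset.mem_insert, Finset.mem_singleton, hπ.eq_iff]
      split_ifs <;> simp [hπ.eq_iff]
  · by_cases hd : d = b
    · subst hd
      simp only [Front.advance, Option.map_some, reduceCtorEq, if_false, if_true, Strand.next, hn.1,
        hb.1, true_and]
      intro a
      constructor
      · simp [hπ.eq_iff]
      · simp only [hb.2, Finset.mem_insert, Finset.mem_singleton, hπ.eq_iff]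
        split_ifs <;> simp [hπ.eq_iff]
    · have : xor e d ≠ xor e b := by simpa using hd
      simpa [Front.advance, hd, this] using h (some d)

theorem Simulates.advances {π : Fin 5 → Fin 5} (hπ : Function.Injective π) {e : Bool} {f g : Front}
    (h : Simulates π e f g) {b : Bool} {r x y : Fin 5} (hg : g.Advances (xor e b) r x y) :
    f.Advances b (π r) (π x) (π y) := by
  have hn := h none
  have hb := h (some b)
  simp only [Option.map_none, Option.map_some] at hn hb
  unfold Front.Advances Strand.Extends at hg ⊢
  simp only [hn.1, hb.1, hn.2, hb.2, Finset.mem_insert, Finset.mem_singleton, hπ.eq_iff,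
    hπ.ne_iff]
  have h₁ := fun a => (hn.2 a).2
  have h₂ := fun a => (hb.2 a).2
  simp only [Finset.mem_insert, Finset.mem_singleton] at hg
  grind

theorem Simulates.closes {π : Fin 5 → Fin 5} (hπ : Function.Injective π) {e : Bool} {f g : Front}
    (h : Simulates π e f g) (hg : g.Closes) : f.Closes := by
  intro σ τ
  have hσ := h σ
  have hτ := h τ
  have hg' := hg (σ.map (xor e)) (τ.map (xor e))
  have hne : σ ≠ τ → σ.map (xor e) ≠ τ.map (xor e) :=
    fun hst he => hst (Option.map_injective (by intro a b; simp) he)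
  rw [hσ.1, hτ.1, (hσ.2 _).1, (hτ.2 _).1, hπ.ne_iff]
  exact ⟨fun hc => hg'.1 ((hσ.2 _).2 hc), fun hst => hg'.2 (hne hst)⟩

/-- A completion of `g`, recolored by `π`, serves for `f`, since the simulation survives every rung.
-/
theorem Simulates.completes {π : Fin 5 → Fin 5} (hπ : Function.Injective π) {e : Bool} {l : List Bool} :
    ∀ {f g : Front}, Simulates π e f g → Completes (l.map (xor e)) g → Completes l f := by
  induction l with
  | nil => exact fun h hg => h.closes hπ hg
  | cons b l ih =>
    rintro f g h ⟨r, x, y, hadv, hc⟩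
    exact ⟨π r, π x, π y, h.advances hπ hadv, ih (h.advance hπ b r x y) hc⟩

/-- Five fronts such that each, whatever the side of the next rung, can be advanced to a renamed one of
them. The first one is the front at the starting pole. -/
def keyFront : Fin 5 → Front
  | 0 => frontOf ⟨0, {0, 1, 2}, ∅⟩ ⟨1, {0, 1, 2}, {0}⟩ ⟨2, {0, 1, 2}, {0, 1}⟩
  | 1 => frontOf ⟨0, {0, 1, 2}, {1}⟩ ⟨2, {1, 2, 3}, {1, 3}⟩ ⟨4, {2, 3, 4}, ∅⟩
  | 2 => frontOf ⟨0, {0, 1, 2}, {1, 2}⟩ ⟨0, {0, 1, 3}, {1, 3}⟩ ⟨0, {0, 1, 4}, {1, 4}⟩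
  | 3 => frontOf ⟨0, {0, 1, 2}, {1}⟩ ⟨1, {1, 2, 3}, {3}⟩ ⟨2, {0, 1, 2}, {0, 1}⟩
  | 4 => frontOf ⟨0, {0, 1, 2}, {1}⟩ ⟨2, {1, 2, 3}, {1, 3}⟩ ⟨4, {1, 2, 4}, ∅⟩

/-- Colors of the three new edges which advance a key front, the renaming and the number of the resulting
key front. -/
def keyMove : Fin 5 → Bool → (Fin 5 × Fin 5 × Fin 5) × (Fin 5 → Fin 5) × Bool × Fin 5
  | 0, false => ((3, 2, 4), ![1, 0, 2, 3, 4], true, 1)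
  | 0, true => ((3, 2, 4), ![0, 1, 2, 3, 4], false, 1)
  | 1, false => ((3, 2, 2), ![2, 3, 0, 1, 4], false, 2)
  | 1, true => ((0, 4, 2), ![4, 0, 2, 1, 3], true, 3)
  | 2, false => ((3, 4, 2), ![4, 3, 0, 1, 2], false, 4)
  | 2, true => ((2, 4, 3), ![4, 2, 0, 1, 3], true, 4)
  | 3, false => ((3, 2, 4), ![1, 3, 2, 0, 4], true, 4)
  | 3, true => ((4, 2, 3), ![0, 1, 2, 4, 3], false, 1)
  | 4, false => ((3, 2, 2), ![2, 3, 0, 1, 4], false, 2)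
  | 4, true => ((0, 4, 2), ![4, 0, 2, 1, 3], true, 3)

/-- Colors of the new edges which complete a key front when three rungs are left. -/
def keyEnd : Fin 5 → Bool → Bool → Bool →
    (Fin 5 × Fin 5 × Fin 5) × (Fin 5 × Fin 5 × Fin 5) × (Fin 5 × Fin 5 × Fin 5)
  | 0, false, false, false => ((3, 1, 4), (2, 3, 1), (0, 4, 3))
  | 0, false, false, true => ((3, 1, 4), (2, 3, 1), (3, 4, 0))
  | 0, false, true, false => ((3, 1, 4), (2, 3, 0), (2, 4, 1))
  | 0, false, true, true => ((3, 1, 4), (2, 3, 0), (1, 2, 4))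
  | 0, true, false, false => ((3, 2, 4), (1, 2, 2), (3, 4, 0))
  | 0, true, false, true => ((3, 2, 4), (1, 2, 2), (0, 4, 3))
  | 0, true, true, false => ((3, 2, 4), (0, 4, 1), (2, 1, 3))
  | 0, true, true, true => ((3, 2, 4), (0, 4, 1), (2, 1, 3))
  | 1, false, false, false => ((3, 2, 0), (1, 4, 2), (3, 0, 4))
  | 1, false, false, true => ((3, 2, 0), (1, 4, 2), (4, 0, 3))
  | 1, false, true, false => ((3, 2, 1), (0, 4, 2), (4, 1, 3))
  | 1, false, true, true => ((3, 2, 1), (0, 4, 2), (1, 3, 4))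
  | 1, true, false, false => ((0, 4, 1), (2, 4, 3), (0, 1, 2))
  | 1, true, false, true => ((0, 4, 1), (2, 4, 3), (2, 1, 0))
  | 1, true, true, false => ((0, 4, 1), (3, 1, 2), (3, 4, 0))
  | 1, true, true, true => ((0, 4, 1), (3, 1, 2), (0, 4, 3))
  | 2, false, false, false => ((3, 4, 2), (0, 1, 1), (3, 2, 4))
  | 2, false, false, true => ((3, 4, 2), (0, 1, 1), (2, 4, 3))
  | 2, false, true, false => ((3, 4, 2), (4, 2, 0), (1, 0, 3))
  | 2, false, true, true => ((3, 4, 2), (4, 2, 0), (1, 0, 3))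
  | 2, true, false, false => ((2, 4, 3), (4, 3, 0), (1, 0, 2))
  | 2, true, false, true => ((2, 4, 3), (4, 3, 0), (1, 0, 2))
  | 2, true, true, false => ((2, 4, 3), (0, 1, 1), (3, 4, 2))
  | 2, true, true, true => ((2, 4, 3), (0, 1, 1), (2, 3, 4))
  | 3, false, false, false => ((3, 2, 4), (1, 4, 0), (3, 0, 2))
  | 3, false, false, true => ((3, 2, 4), (1, 4, 0), (2, 0, 3))
  | 3, false, true, false => ((3, 2, 4), (0, 2, 2), (1, 4, 3))
  | 3, false, true, true => ((3, 2, 4), (0, 2, 2), (3, 4, 1))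
  | 3, true, false, false => ((4, 0, 3), (2, 4, 1), (0, 2, 3))
  | 3, true, false, true => ((4, 0, 3), (2, 4, 1), (2, 3, 0))
  | 3, true, true, false => ((4, 0, 3), (2, 1, 0), (4, 2, 3))
  | 3, true, true, true => ((4, 0, 3), (2, 1, 0), (3, 2, 4))
  | 4, false, false, false => ((3, 2, 0), (1, 4, 2), (3, 0, 4))
  | 4, false, false, true => ((3, 2, 0), (1, 4, 2), (4, 0, 3))
  | 4, false, true, false => ((3, 2, 1), (0, 4, 2), (4, 1, 3))
  | 4, false, true, true => ((3, 2, 1), (0, 4, 2), (1, 3, 4))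
  | 4, true, false, false => ((0, 4, 1), (2, 4, 3), (0, 1, 2))
  | 4, true, false, true => ((0, 4, 1), (2, 4, 3), (2, 1, 0))
  | 4, true, true, false => ((0, 4, 1), (3, 1, 2), (3, 4, 0))
  | 4, true, true, true => ((0, 4, 1), (3, 1, 2), (0, 4, 3))

/-- A finite check of ten cases; this closure of the five fronts drives the induction over
arbitrarily many rungs. -/
theorem keyMove_spec : ∀ (i : Fin 5) (b : Bool),
    Function.Injective (keyMove i b).2.1 ∧
    (keyFront i).Advances b (keyMove i b).1.1 (keyMove i b).1.2.1 (keyMove i b).1.2.2 ∧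
    Simulates (keyMove i b).2.1 (keyMove i b).2.2.1
      ((keyFront i).advance b (keyMove i b).1.1 (keyMove i b).1.2.1 (keyMove i b).1.2.2)
      (keyFront (keyMove i b).2.2.2) := by
  decide +kernel

theorem completes_keyFront_of_length_eq_three : ∀ (i : Fin 5) (b₁ b₂ b₃ : Bool),
    Completes [b₁, b₂, b₃] (keyFront i) := by
  have key : ∀ (i : Fin 5) (b₁ b₂ b₃ : Bool),
      let m := keyEnd i b₁ b₂ b₃
      let f₁ := (keyFront i).advance b₁ m.1.1 m.1.2.1 m.1.2.2
      let f₂ := f₁.advance b₂ m.2.1.1 m.2.1.2.1 m.2.1.2.2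
      let f₃ := f₂.advance b₃ m.2.2.1 m.2.2.2.1 m.2.2.2.2
      (keyFront i).Advances b₁ m.1.1 m.1.2.1 m.1.2.2 ∧
      f₁.Advances b₂ m.2.1.1 m.2.1.2.1 m.2.1.2.2 ∧
      f₂.Advances b₃ m.2.2.1 m.2.2.2.1 m.2.2.2.2 ∧ f₃.Closes := by
    decide +kernel
  intro i b₁ b₂ b₃
  obtain ⟨h₁, h₂, h₃, h₄⟩ := key i b₁ b₂ b₃
  exact ⟨_, _, _, h₁, _, _, _, h₂, _, _, _, h₃, h₄⟩

/-- Key moves absorb the rungs one by one until exactly three are left, and those are completed from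
the table. -/
theorem completes_keyFront : ∀ (l : List Bool), 3 ≤ l.length → ∀ i, Completes l (keyFront i)
  | [], h, _ => by simp at h
  | [_], h, _ => by simp at h
  | [_, _], h, _ => by simp at h
  | [b₁, b₂, b₃], _, i => completes_keyFront_of_length_eq_three i b₁ b₂ b₃
  | b :: b₁ :: b₂ :: b₃ :: l, _, i => by
    obtain ⟨hπ, hadv, hsim⟩ := keyMove_spec i b
    refine ⟨_, _, _, hadv, hsim.completes hπ ?_⟩
    exact completes_keyFront _ (by simp) _
  termination_by l => l.length

theorem completes_singleton (b : Bool) : Completes [b] (keyFront 0) := by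
  have key : ∀ b, (keyFront 0).Advances b 3 2 4 ∧ ((keyFront 0).advance b 3 2 4).Closes := by
    decide +kernel
  exact ⟨3, 2, 4, key b⟩

end HalinStar

/-! ### From fronts to a coloring of the graph -/

namespace HalinStar

/-- The vertex in position `i` of a strand; all three strands start in the pole `0` and end in the pole
`n + 1`. -/
def node (n : ℕ) (σ : Option Bool) (i : ℕ) : Option Bool × ℕ :=
  if i = 0 ∨ i = n + 1 then (none, i) else (σ, i)

/-- The strand `σ` has a vertex in position `i`: rungs join the spine to the rail on the side `s i`. -/
def OnStrand (n : ℕ) (s : ℕ → Bool) (σ : Option Bool) (i : ℕ) : Prop :=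
  i = 0 ∨ i = n + 1 ∨ σ = none ∨ σ = some (s i)

/-- Positions `j < k` are consecutive on the strand `σ`. -/
structure StrandEdge (n : ℕ) (s : ℕ → Bool) (σ : Option Bool) (j k : ℕ) : Prop where
  lt : j < k
  le : k ≤ n + 1
  left : OnStrand n s σ j
  right : OnStrand n s σ k
  between : ∀ m, j < m → m < k → ¬ OnStrand n s σ m

/-- The edges of the graph formed by three strands and the rungs, in one direction. -/
inductive Link (n : ℕ) (s : ℕ → Bool) : Option Bool × ℕ → Option Bool × ℕ → Prop
  | strand (σ : Option Bool) (j k : ℕ) (h : StrandEdge n s σ j k) : Link n s (node n σ j) (node n σ k)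
  | rung (i : ℕ) (h₁ : 1 ≤ i) (h₂ : i ≤ n) : Link n s (none, i) (some (s i), i)

theorem StrandEdge.right_unique {n : ℕ} {s : ℕ → Bool} {σ : Option Bool} {j k k' : ℕ}
    (h : StrandEdge n s σ j k) (h' : StrandEdge n s σ j k') : k = k' := by
  rcases lt_trichotomy k k' with hlt | rfl | hlt
  · exact absurd h.right (h'.between k h.lt hlt)
  · rfl
  · exact absurd h'.right (h.between k' h'.lt hlt)

theorem StrandEdge.left_unique {n : ℕ} {s : ℕ → Bool} {σ : Option Bool} {j j' k : ℕ}
    (h : StrandEdge n s σ j k) (h' : StrandEdge n s σ j' k) : j = j' := by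
  rcases lt_trichotomy j j' with hlt | rfl | hlt
  · exact absurd h'.left (h.between j' hlt h'.lt)
  · rfl
  · exact absurd h.left (h'.between j hlt h.lt)

theorem node_snd (n : ℕ) (σ : Option Bool) (i : ℕ) : (node n σ i).2 = i := by
  unfold node; split_ifs <;> rfl

theorem node_of_inner {n : ℕ} (σ : Option Bool) {i : ℕ} (h₁ : 1 ≤ i) (h₂ : i ≤ n) :
    node n σ i = (σ, i) := if_neg (by omega)

/-- A coloring of the strands and rungs: the fronts at all cuts and the colors of the rungs. -/
structure Run (n : ℕ) (s : ℕ → Bool) (F : ℕ → Front) (r : ℕ → Fin 5) : Prop where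
  zero : F 0 = keyFront 0
  step : ∀ i < n, ∃ x y, (F i).Advances (s (i + 1)) (r (i + 1)) x y ∧
    F (i + 1) = (F i).advance (s (i + 1)) (r (i + 1)) x y
  closes : (F n).Closes

theorem Completes.exists_fronts : ∀ (n : ℕ) (s : ℕ → Bool) (f : Front),
    Completes ((List.range n).map s) f →
    ∃ (F : ℕ → Front) (r : ℕ → Fin 5), F 0 = f ∧ (∀ i < n, ∃ x y, (F i).Advances (s i) (r i) x y ∧
      F (i + 1) = (F i).advance (s i) (r i) x y) ∧ (F n).Closes
  | 0, s, f, h => ⟨fun _ => f, fun _ => 0, rfl, by simp, h⟩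
  | n + 1, s, f, h => by
    rw [List.range_succ_eq_map, List.map_cons, List.map_map] at h
    obtain ⟨r₀, x, y, hadv, hc⟩ := h
    obtain ⟨F, r, h₀, hstep, hclose⟩ := exists_fronts n (s ∘ Nat.succ) _ hc
    refine ⟨fun i => Nat.casesOn i f F, fun i => Nat.casesOn i r₀ r, rfl, ?_, hclose⟩
    rintro (_ | i) hi
    · exact ⟨x, y, hadv, h₀⟩
    · exact hstep i (by omega)

theorem exists_run {n : ℕ} (hn : n = 1 ∨ 3 ≤ n) (s : ℕ → Bool) : ∃ F r, Run n s F r := by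
  have hc : Completes ((List.range n).map fun i => s (i + 1)) (keyFront 0) := by
    rcases hn with rfl | hn
    · exact completes_singleton _
    · exact completes_keyFront _ (by simpa using hn) 0
  obtain ⟨F, r, h₀, hstep, hclose⟩ := Completes.exists_fronts n _ _ hc
  -- `Completes.exists_fronts` counts rungs from 0, a `Run` counts them from 1.
  refine ⟨F, fun i => r (i - 1), h₀, fun i hi => ?_, hclose⟩
  simpa using hstep i hi

namespace Run

variable {n : ℕ} {s : ℕ → Bool} {F : ℕ → Front} {r : ℕ → Fin 5}

/-- The strand along which the vertices `(σ, i)` and `(τ, j)` with `i < j` can be consecutive. -/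
def strandOf (n : ℕ) (s : ℕ → Bool) (σ τ : Option Bool) (i j : ℕ) : Option Bool :=
  if j = n + 1 then if i = 0 then some (!s 1) else σ else τ

/-- The color of an edge. -/
def color (n : ℕ) (s : ℕ → Bool) (F : ℕ → Front) (r : ℕ → Fin 5) (x y : Option Bool × ℕ) : Fin 5 :=
  if x.2 = y.2 then r x.2
  else if x.2 < y.2 then (F x.2 (strandOf n s x.1 y.1 x.2 y.2)).col
  else (F y.2 (strandOf n s y.1 x.1 y.2 x.2)).col

/-- The colors at a vertex. -/
def palette (n : ℕ) (F : ℕ → Front) (x : Option Bool × ℕ) : Finset (Fin 5) :=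
  if x.2 = n + 1 then Finset.univ.image fun σ => (F n σ).col else (F x.2 x.1).pal

theorem color_symm (x y : Option Bool × ℕ) : color n s F r x y = color n s F r y x := by
  unfold color
  rcases lt_trichotomy x.2 y.2 with h | h | h
  · rw [if_neg h.ne, if_pos h, if_neg h.ne', if_neg h.asymm]
  · rw [if_pos h, if_pos h.symm, h]
  · rw [if_neg h.ne', if_neg h.asymm, if_neg h.ne, if_pos h]

theorem color_strand (hn : 1 ≤ n) {σ : Option Bool} {j k : ℕ} (h : StrandEdge n s σ j k) :
    color n s F r (node n σ j) (node n σ k) = (F j σ).col := by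
  have hlt := h.lt
  have hle := h.le
  unfold color
  rw [node_snd, node_snd, if_neg hlt.ne, if_pos hlt]
  congr 2
  unfold strandOf
  split_ifs with h₁ h₂
  -- Poles carry the label `none` on every strand, so here neither end reveals the strand. An edge
  -- joining the two poles lies on a rail without rungs, which must be the one opposite to the first
  -- rung.
  · subst h₁ h₂
    have := h.between 1 (by omega) (by omega)
    unfold OnStrand at this
    push Not at this
    rcases σ with _ | b
    · simp at this
    · have h4 := this.2.2.2
      simp only [ne_eq, Option.some.injEq] at h4 ⊢
      cases b <;> cases hs : s 1 <;> simp_all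
  · rw [node_of_inner σ (by omega) (by omega)]
  · rw [node_of_inner σ (by omega) (by omega)]

theorem color_rung (σ τ : Option Bool) (i : ℕ) : color n s F r (σ, i) (τ, i) = r i := if_pos rfl

/-- Advancing alters only the spine and the rail of the rung, so a strand keeps its data while rungs
elsewhere are passed. -/
theorem apply_eq (R : Run n s F r) {σ : Option Bool} {j k m : ℕ} (h : StrandEdge n s σ j k)
    (hj : j ≤ m) (hm : m < k) : F m σ = F j σ := by
  have hle := h.le
  induction m, hj using Nat.le_induction with
  | base => rfl
  | succ m hj ih =>
    rw [← ih (by omega)]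
    obtain ⟨x, y, -, hF⟩ := R.step m (by omega)
    have := h.between (m + 1) (by omega) hm
    unfold OnStrand at this
    push Not at this
    rw [hF, Front.advance, if_neg this.2.2.1, if_neg this.2.2.2]

theorem inner (R : Run n s F r) {i : ℕ} (hi : i < n) {σ τ : Option Bool}
    (h : σ = none ∧ τ = some (s (i + 1)) ∨ σ = some (s (i + 1)) ∧ τ = none) :
    (F i σ).Extends (r (i + 1)) (F (i + 1) σ).col (palette n F (τ, i + 1)) ∧
    F (i + 1) σ = (F i σ).next (r (i + 1)) (F (i + 1) σ).col (palette n F (τ, i + 1)) := by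
  obtain ⟨x, y, ⟨h₁, h₂⟩, hF⟩ := R.step i hi
  have hpal : ∀ τ, palette n F (τ, i + 1) = (F (i + 1) τ).pal := fun τ => if_neg (by simp; omega)
  rw [hpal, hF]
  rcases h with ⟨rfl, rfl⟩ | ⟨rfl, rfl⟩
  · exact ⟨by simpa [Front.advance, Strand.next] using h₁, by simp [Front.advance, Strand.next]⟩
  · exact ⟨by simpa [Front.advance, Strand.next] using h₂, by simp [Front.advance, Strand.next]⟩

theorem palette_inner (R : Run n s F r) {i : ℕ} (hi : i < n) {σ τ : Option Bool}
    (h : σ = none ∧ τ = some (s (i + 1)) ∨ σ = some (s (i + 1)) ∧ τ = none) :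
    palette n F (σ, i + 1) = {(F i σ).col, r (i + 1), (F (i + 1) σ).col} := by
  unfold palette
  rw [if_neg (by simp; omega)]
  simp only
  rw [(R.inner hi h).2]
  simp [Strand.next]

theorem exists_partner {i : ℕ} {σ : Option Bool} (h : OnStrand n s σ i) (h₁ : 1 ≤ i) (h₂ : i ≤ n) :
    ∃ τ, σ = none ∧ τ = some (s i) ∨ σ = some (s i) ∧ τ = none := by
  rcases h with h | h | h | h
  · omega
  · omega
  · exact ⟨_, .inl ⟨h, rfl⟩⟩
  · exact ⟨_, .inr ⟨h, rfl⟩⟩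

/-- At the starting pole the star condition for two strands involves both right ends, neither yet
colored. It is secured in advance by a ban on one of the two: this is the role of the forbidden sets
in front 0. -/
theorem keyFront_zero_start : ∀ σ τ, (keyFront 0 σ).pal = (keyFront 0 none).pal ∧
    (keyFront 0 σ).col ∈ (keyFront 0 none).pal ∧ (σ ≠ τ → (keyFront 0 σ).col ≠ (keyFront 0 τ).col ∧
      ((keyFront 0 σ).col ∈ (keyFront 0 τ).forb ∨ (keyFront 0 τ).col ∈ (keyFront 0 σ).forb)) := by
  decide +kernel

theorem palette_left (R : Run n s F r) {σ : Option Bool} {j k : ℕ} (h : StrandEdge n s σ j k) :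
    palette n F (node n σ j) = (F j σ).pal := by
  have := h.lt; have := h.le
  unfold palette
  rw [node_snd, if_neg (by omega)]
  rcases Nat.eq_zero_or_pos j with rfl | hj
  · rw [R.zero, (keyFront_zero_start σ σ).1]; rfl
  · rw [node_of_inner σ hj (by omega)]

/-- A ban recorded at the left end is honored when the right end is reached: by `Strand.Extends` at
an inner vertex, by `Front.Closes` at the last pole. -/
theorem notMem_forb (R : Run n s F r) {σ : Option Bool} {j k : ℕ} (h : StrandEdge n s σ j k)
    {a : Fin 5} (ha : a ∈ (F j σ).forb) : a ∉ palette n F (node n σ k) := by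
  have := h.lt; have := h.le
  obtain ⟨k, rfl⟩ : ∃ k', k = k' + 1 := ⟨k - 1, by omega⟩
  rw [← R.apply_eq h (m := k) (by omega) (by omega)] at ha
  rcases Nat.lt_or_ge k n with hk | hk
  · obtain ⟨τ, hτ⟩ := exists_partner h.right (by omega) hk
    rw [node_of_inner σ (by omega) hk, R.palette_inner hk hτ]
    have := (R.inner hk hτ).1.2.2.2.1
    simp only [Finset.mem_insert, Finset.mem_singleton]
    rintro (rfl | rfl | rfl)
    exacts [this.1 ha, this.2.1 ha, this.2.2 ha]
  · obtain rfl : k = n := by omega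
    unfold palette
    rw [node_snd, if_pos rfl]
    simp only [Finset.mem_image, Finset.mem_univ, true_and, not_exists]
    rintro τ rfl
    exact (R.closes σ τ).1 ha

theorem col_mem_left (R : Run n s F r) {σ : Option Bool} {j k : ℕ} (h : StrandEdge n s σ j k) :
    (F j σ).col ∈ palette n F (node n σ j) := by
  have := h.lt; have := h.le
  rw [R.palette_left h]
  rcases Nat.eq_zero_or_pos j with rfl | hj
  · rw [R.zero, (keyFront_zero_start σ σ).1]
    exact (keyFront_zero_start σ σ).2.1
  · obtain ⟨j, rfl⟩ : ∃ j', j = j' + 1 := ⟨j - 1, by omega⟩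
    obtain ⟨τ, hτ⟩ := exists_partner h.left hj (by omega)
    rw [(R.inner (by omega) hτ).2]
    simp [Strand.next]

theorem col_mem_right (R : Run n s F r) {σ : Option Bool} {j k : ℕ} (h : StrandEdge n s σ j k) :
    (F j σ).col ∈ palette n F (node n σ k) := by
  have := h.lt; have := h.le
  obtain ⟨k, rfl⟩ : ∃ k', k = k' + 1 := ⟨k - 1, by omega⟩
  rw [← R.apply_eq h (m := k) (by omega) (by omega)]
  rcases Nat.lt_or_ge k n with hk | hk
  · obtain ⟨τ, hτ⟩ := exists_partner h.right (by omega) hk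
    rw [node_of_inner σ (by omega) hk, R.palette_inner hk hτ]
    simp
  · obtain rfl : k = n := by omega
    unfold palette
    rw [node_snd, if_pos rfl]
    exact Finset.mem_image_of_mem _ (Finset.mem_univ _)

theorem color_mem_palette (R : Run n s F r) (hn : 1 ≤ n) {x y : Option Bool × ℕ}
    (h : Link n s x y ∨ Link n s y x) : color n s F r x y ∈ palette n F x := by
  have rung : ∀ i σ τ, i < n →
      (σ = none ∧ τ = some (s (i + 1)) ∨ σ = some (s (i + 1)) ∧ τ = none) →
      color n s F r (σ, i + 1) (τ, i + 1) ∈ palette n F (σ, i + 1) := by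
    intro i σ τ hi h
    rw [R.palette_inner hi h, color_rung]
    simp
  rcases h with h | h
  · rcases h with ⟨σ, j, k, h⟩ | ⟨i, h₁, h₂⟩
    · rw [color_strand hn h]
      exact R.col_mem_left h
    · obtain ⟨i, rfl⟩ : ∃ i', i = i' + 1 := ⟨i - 1, by omega⟩
      exact rung i _ _ h₂ (.inl ⟨rfl, rfl⟩)
  · rcases h with ⟨σ, j, k, h⟩ | ⟨i, h₁, h₂⟩
    · rw [color_symm, color_strand hn h]
      exact R.col_mem_right h
    · obtain ⟨i, rfl⟩ : ∃ i', i = i' + 1 := ⟨i - 1, by omega⟩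
      exact rung i _ _ h₂ (.inr ⟨rfl, rfl⟩)

/-- The star condition at the path `x v y`. -/
def Local (n : ℕ) (s : ℕ → Bool) (F : ℕ → Front) (r : ℕ → Fin 5) (v x y : Option Bool × ℕ) : Prop :=
  color n s F r v x ≠ color n s F r v y ∧
    ¬ (color n s F r v y ∈ palette n F x ∧ color n s F r v x ∈ palette n F y)

theorem Local.symm {v x y : Option Bool × ℕ} (h : Local n s F r v x y) : Local n s F r v y x :=
  ⟨h.1.symm, fun hc => h.2 hc.symm⟩

theorem node_inj {σ τ : Option Bool} {i j : ℕ} (h : node n σ i = node n τ j) :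
    i = j ∧ (1 ≤ i → i ≤ n → σ = τ) := by
  have hij : i = j := by rw [← node_snd n σ i, h, node_snd]
  refine ⟨hij, fun h₁ h₂ => ?_⟩
  subst hij
  rw [node_of_inner σ h₁ h₂, node_of_inner τ h₁ h₂] at h
  exact congrArg Prod.fst h

/-- Two edges can leave a vertex to the right only at the starting pole, where the one-sided bans of
the initial front apply. -/
theorem local_right_right (R : Run n s F r) (hn : 1 ≤ n) {σ τ : Option Bool} {i j k : ℕ}
    (h : StrandEdge n s σ i j) (h' : StrandEdge n s τ i k) (hv : node n σ i = node n τ i)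
    (hne : node n σ j ≠ node n τ k) : Local n s F r (node n σ i) (node n σ j) (node n τ k) := by
  have := h.lt; have := h.le
  have hst : σ ≠ τ := by
    rintro rfl
    rw [h.right_unique h'] at hne
    exact hne rfl
  have hi : i = 0 := by
    by_contra hi
    exact hst ((node_inj hv).2 (by omega) (by omega))
  subst hi
  have key := (keyFront_zero_start σ τ).2.2 hst
  unfold Local
  rw [color_strand hn h, hv, color_strand hn h']
  have f₁ := fun a => R.notMem_forb h (a := a)
  have f₂ := fun a => R.notMem_forb h' (a := a)
  rw [R.zero] at f₁ f₂ ⊢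
  grind

/-- Two edges can arrive from the left only at the last pole, where `Front.Closes` is the star
condition itself. -/
theorem local_left_left (R : Run n s F r) (hn : 1 ≤ n) {σ τ : Option Bool} {i j k : ℕ}
    (h : StrandEdge n s σ j i) (h' : StrandEdge n s τ k i) (hv : node n σ i = node n τ i)
    (hne : node n σ j ≠ node n τ k) : Local n s F r (node n σ i) (node n σ j) (node n τ k) := by
  have := h.lt; have := h.le; have := h'.lt
  have hst : σ ≠ τ := by
    rintro rfl
    rw [h.left_unique h'] at hne
    exact hne rfl
  have hi : i = n + 1 := by
    by_contra hi
    exact hst ((node_inj hv).2 (by omega) (by omega))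
  subst hi
  have key := (R.closes σ τ).2 hst
  unfold Local
  rw [color_symm, color_strand hn h, hv, color_symm (node n τ _), color_strand hn h',
    R.palette_left h, R.palette_left h', ← R.apply_eq h (m := n) (by omega) (by omega),
    ← R.apply_eq h' (m := n) (by omega) (by omega)]
  exact ⟨key.1, fun hc => key.2 hc.symm⟩

/-- If the right edge's color already occurs at the left neighbor, `Strand.next` has banned the left
edge's color at the right neighbor. -/
theorem local_left_right (R : Run n s F r) (hn : 1 ≤ n) {σ : Option Bool} {i j k : ℕ}
    (h : StrandEdge n s σ j i) (h' : StrandEdge n s σ i k) :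
    Local n s F r (node n σ i) (node n σ j) (node n σ k) := by
  have := h.lt; have := h'.lt; have := h'.le
  obtain ⟨i, rfl⟩ : ∃ i', i = i' + 1 := ⟨i - 1, by omega⟩
  obtain ⟨τ, hτ⟩ := exists_partner h.right (by omega) (by omega)
  obtain ⟨hext, hnext⟩ := R.inner (by omega) hτ
  have f := fun a => R.notMem_forb h' (a := a)
  rw [hnext] at f
  unfold Local
  rw [color_symm, color_strand hn h, color_strand hn h', R.palette_left h,
    ← R.apply_eq h (m := i) (by omega) (by omega)]
  refine ⟨hext.2.1, fun hc => f _ ?_ hc.2⟩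
  simp [Strand.next, hc.1]

theorem local_left_rung (R : Run n s F r) (hn : 1 ≤ n) {σ τ : Option Bool} {i j : ℕ}
    (h : StrandEdge n s σ j (i + 1)) (hi : i < n)
    (hτ : σ = none ∧ τ = some (s (i + 1)) ∨ σ = some (s (i + 1)) ∧ τ = none) :
    Local n s F r (σ, i + 1) (node n σ j) (τ, i + 1) := by
  have := h.lt
  obtain ⟨hext, -⟩ := R.inner hi hτ
  unfold Local
  rw [color_rung, ← node_of_inner (n := n) σ (i := i + 1) (by omega) hi, color_symm,
    color_strand hn h, R.palette_left h, ← R.apply_eq h (m := i) (by omega) (by omega)]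
  exact ⟨hext.1, hext.2.2.2.2⟩

theorem local_right_rung (R : Run n s F r) (hn : 1 ≤ n) {σ τ : Option Bool} {i k : ℕ}
    (h : StrandEdge n s σ (i + 1) k) (hi : i < n)
    (hτ : σ = none ∧ τ = some (s (i + 1)) ∨ σ = some (s (i + 1)) ∧ τ = none) :
    Local n s F r (σ, i + 1) (node n σ k) (τ, i + 1) := by
  obtain ⟨hext, hnext⟩ := R.inner hi hτ
  have f := fun a => R.notMem_forb h (a := a)
  rw [hnext] at f
  unfold Local
  rw [color_rung, ← node_of_inner (n := n) σ (i := i + 1) (by omega) hi, color_strand hn h]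
  refine ⟨hext.2.2.1.symm, fun hc => f _ ?_ hc.1⟩
  simp [Strand.next, hc.2]

/-- The neighbors of a vertex: along a strand to the right or to the left, or along a rung. -/
inductive Nbr (n : ℕ) (s : ℕ → Bool) : Option Bool × ℕ → Option Bool × ℕ → Prop
  | right (σ : Option Bool) (i k : ℕ) (h : StrandEdge n s σ i k) : Nbr n s (node n σ i) (node n σ k)
  | left (σ : Option Bool) (j i : ℕ) (h : StrandEdge n s σ j i) : Nbr n s (node n σ i) (node n σ j)
  | rung (σ τ : Option Bool) (i : ℕ) (hi : i < n)
      (h : σ = none ∧ τ = some (s (i + 1)) ∨ σ = some (s (i + 1)) ∧ τ = none) :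
      Nbr n s (σ, i + 1) (τ, i + 1)

theorem nbr_of_link {x y : Option Bool × ℕ} (h : Link n s x y ∨ Link n s y x) : Nbr n s x y := by
  rcases h with h | h
  · rcases h with ⟨σ, j, k, h⟩ | ⟨i, h₁, h₂⟩
    · exact .right σ j k h
    · obtain ⟨i, rfl⟩ : ∃ i', i = i' + 1 := ⟨i - 1, by omega⟩
      exact .rung _ _ i h₂ (.inl ⟨rfl, rfl⟩)
  · rcases h with ⟨σ, j, k, h⟩ | ⟨i, h₁, h₂⟩
    · exact .left σ j k h
    · obtain ⟨i, rfl⟩ : ∃ i', i = i' + 1 := ⟨i - 1, by omega⟩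
      exact .rung _ _ i h₂ (.inr ⟨rfl, rfl⟩)

theorem local_of_nbr (R : Run n s F r) (hn : 1 ≤ n) {v w x y : Option Bool × ℕ} (hx : Nbr n s v x)
    (hy : Nbr n s w y) (hvw : v = w) (hxy : x ≠ y) : Local n s F r v x y := by
  cases hx with
  | right σ i k h =>
    cases hy with
    | right τ i' k' h' =>
      obtain rfl := (node_inj hvw).1
      exact R.local_right_right hn h h' hvw hxy
    | left τ j i' h' =>
      obtain rfl := (node_inj hvw).1
      have := h.lt; have := h.le; have := h'.lt
      obtain rfl := (node_inj hvw).2 (by omega) (by omega)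
      exact (R.local_left_right hn h' h).symm
    | rung τ ρ i' hi hτ =>
      rw [← node_of_inner (n := n) τ (i := i' + 1) (by omega) hi] at hvw
      obtain rfl := (node_inj hvw).1
      obtain rfl := (node_inj hvw).2 (by omega) hi
      rw [node_of_inner (n := n) σ (i := i' + 1) (by omega) hi]
      exact R.local_right_rung hn h hi hτ
  | left σ j i h =>
    cases hy with
    | right τ i' k' h' =>
      obtain rfl := (node_inj hvw).1
      have := h.lt; have := h'.le; have := h'.lt
      obtain rfl := (node_inj hvw).2 (by omega) (by omega)
      exact R.local_left_right hn h h'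
    | left τ j' i' h' =>
      obtain rfl := (node_inj hvw).1
      exact R.local_left_left hn h h' hvw hxy
    | rung τ ρ i' hi hτ =>
      rw [← node_of_inner (n := n) τ (i := i' + 1) (by omega) hi] at hvw
      obtain rfl := (node_inj hvw).1
      obtain rfl := (node_inj hvw).2 (by omega) hi
      rw [node_of_inner (n := n) σ (i := i' + 1) (by omega) hi]
      exact R.local_left_rung hn h hi hτ
  | rung σ ρ i hi hσ =>
    cases hy with
    | right τ i' k' h' =>
      rw [← node_of_inner (n := n) σ (i := i + 1) (by omega) hi] at hvw
      obtain rfl := (node_inj hvw).1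
      obtain rfl := (node_inj hvw).2 (by omega) hi
      exact (R.local_right_rung hn h' hi hσ).symm
    | left τ j i' h' =>
      rw [← node_of_inner (n := n) σ (i := i + 1) (by omega) hi] at hvw
      obtain rfl := (node_inj hvw).1
      obtain rfl := (node_inj hvw).2 (by omega) hi
      exact (R.local_left_rung hn h' hi hσ).symm
    | rung τ ρ' i' hi' hτ =>
      simp only [Prod.mk.injEq] at hvw
      obtain ⟨rfl, h₂⟩ := hvw
      obtain rfl : i = i' := by omega
      exfalso
      apply hxy
      grind

end Run

/-- A graph which embeds into three strands joined by `n` rungs, where `n = 1` or `n ≥ 3`, has a star edge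
coloring with five colors. -/
theorem starEdgeColorable_five_of_link {V : Type*} {G : SimpleGraph V} {n : ℕ} {s : ℕ → Bool}
    (hn : n = 1 ∨ 3 ≤ n) (f : V → Option Bool × ℕ) (hf : Function.Injective f)
    (hG : ∀ x y, G.Adj x y → Link n s (f x) (f y) ∨ Link n s (f y) (f x)) :
    StarEdgeColorable G 5 := by
  obtain ⟨F, r, R⟩ := exists_run hn s
  have hn' : 1 ≤ n := by omega
  refine starEdgeColorable_of_local (fun x y => Run.color n s F r (f x) (f y))
    (fun x => Run.palette n F (f x)) (fun x y => Run.color_symm _ _)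
    (fun x y h => R.color_mem_palette hn' (hG x y h)) ?_
  intro v x y hx hy hxy
  exact R.local_of_nbr hn' (Run.nbr_of_link (hG v x hx)) (Run.nbr_of_link (hG v y hy)) rfl
    (hf.ne hxy)

end HalinStar

namespace HalinStar
variable {V : Type*}

/-! ### Rotation systems -/

namespace RotationSystem

variable {G : SimpleGraph V} (R : RotationSystem G)

/-- In the cyclic order around `u` the neighbor `x` is followed by `y`. -/
def Turn (u x y : V) : Prop :=
  ∃ (h : G.Adj u x) (h' : G.Adj u y), R.rot ⟨(u, x), h⟩ = ⟨(u, y), h'⟩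

/-- The darts `(a, b)` and `(c, d)` belong to the same facial walk. -/
def SameFace (a b c d : V) : Prop :=
  ∃ (h : G.Adj a b) (h' : G.Adj c d), R.faceMap.SameCycle ⟨(a, b), h⟩ ⟨(c, d), h'⟩

variable {R}

theorem SameFace.symm {a b c d : V} : R.SameFace a b c d → R.SameFace c d a b :=
  fun ⟨h, h', hs⟩ => ⟨h', h, hs.symm⟩

theorem SameFace.trans {a b c d e f : V} :
    R.SameFace a b c d → R.SameFace c d e f → R.SameFace a b e f :=
  fun ⟨h, _, hs⟩ ⟨_, h₃, hs'⟩ => ⟨h, h₃, hs.trans hs'⟩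

theorem SameFace.refl {a b : V} (h : G.Adj a b) : R.SameFace a b a b := ⟨h, h, .rfl⟩

/-- The face map sends the dart `(x, u)` to the rotation of its reversal `(u, x)`. -/
theorem Turn.sameFace {u x y : V} : R.Turn u x y → R.SameFace x u u y := fun ⟨h, h', hr⟩ =>
  ⟨h.symm, h', by rw [← hr]; exact Equiv.Perm.sameCycle_apply_right.2 .rfl⟩

theorem exists_turn {u x : V} (h : G.Adj u x) : ∃ y, R.Turn u x y := by
  have hf := R.rot_fst ⟨(u, x), h⟩
  generalize hd : R.rot ⟨(u, x), h⟩ = d at hf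
  obtain ⟨⟨a, b⟩, hab⟩ := d
  obtain rfl : a = u := hf
  exact ⟨b, h, hab, hd⟩

theorem Turn.right_unique {u x y y' : V} : R.Turn u x y → R.Turn u x y' → y = y' :=
  fun ⟨_, _, h⟩ ⟨_, _, h'⟩ => by
    have := h.symm.trans h'
    simp only [SimpleGraph.Dart.mk.injEq, Prod.mk.injEq] at this
    exact this.2

theorem Turn.left_unique {u x x' y : V} : R.Turn u x y → R.Turn u x' y → x = x' :=
  fun ⟨_, _, h⟩ ⟨_, _, h'⟩ => by
    have := R.rot.injective (h.trans h'.symm)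
    simp only [SimpleGraph.Dart.mk.injEq, Prod.mk.injEq] at this
    exact this.2

/-- A set of neighbors which is closed under turning contains all of them. -/
theorem turn_induction {u x : V} (hx : G.Adj u x) {P : V → Prop} (h₀ : P x)
    (hright : ∀ y z, R.Turn u y z → P y → P z) (hleft : ∀ y z, R.Turn u y z → P z → P y) {y : V}
    (hy : G.Adj u y) : P y := by
  obtain ⟨i, hi⟩ := R.cyclic ⟨(u, x), hx⟩ ⟨(u, y), hy⟩ rfl
  have key : ∀ i : ℤ, ∃ (z : V) (hz : G.Adj u z), (R.rot ^ i) ⟨(u, x), hx⟩ = ⟨(u, z), hz⟩ ∧ P z := by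
    intro i
    induction i with
    | zero => exact ⟨x, hx, rfl, h₀⟩
    | succ n ih =>
      obtain ⟨z, hz, hpow, hP⟩ := ih
      obtain ⟨z', hz'⟩ := R.exists_turn hz
      obtain ⟨_, hz'', hrot⟩ := id hz'
      refine ⟨z', hz'', ?_, hright z z' hz' hP⟩
      rw [add_comm, zpow_add, zpow_one, Equiv.Perm.mul_apply, hpow, hrot]
    | pred n ih =>
      obtain ⟨z, hz, hpow, hP⟩ := ih
      have hrot : R.rot (R.rot⁻¹ ⟨(u, z), hz⟩) = ⟨(u, z), hz⟩ := Equiv.apply_symm_apply _ _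
      generalize hd : R.rot⁻¹ ⟨(u, z), hz⟩ = d at hrot
      have hf := R.rot_fst d
      rw [hrot] at hf
      obtain ⟨⟨a, b⟩, hab⟩ := d
      obtain rfl : u = a := hf
      refine ⟨b, hab, ?_, hleft b z ⟨hab, hz, hrot⟩ hP⟩
      rw [sub_eq_neg_add, zpow_add, zpow_neg_one, Equiv.Perm.mul_apply, hpow, hd]
  obtain ⟨z, hz, hpow, hP⟩ := key i
  rw [hi] at hpow
  simp only [SimpleGraph.Dart.mk.injEq, Prod.mk.injEq] at hpow
  rwa [hpow.2]

/-- A turn at a vertex of degree three determines the cyclic order around it. -/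
theorem Turn.cyclic {u a b c : V} (hab : a ≠ b) (hac : a ≠ c) (hbc : b ≠ c)
    (hu : ∀ x, G.Adj u x ↔ x = a ∨ x = b ∨ x = c) (h : R.Turn u a b) :
    R.Turn u b c ∧ R.Turn u c a := by
  have ha := (hu a).2 (by simp)
  have hb := (hu b).2 (by simp)
  have hc := (hu c).2 (by simp)
  obtain ⟨y, hy⟩ := R.exists_turn hb
  have hyu : G.Adj u y := hy.2.1
  have hbc' : R.Turn u b c := by
    rcases (hu y).1 hyu with rfl | rfl | rfl
    -- If the rotation returned from `b` to `a`, then `{a, b}` would be closed under turning and `c`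
    -- could not be reached.
    · exfalso
      have : c = y ∨ c = b := by
        refine R.turn_induction (P := fun z => z = y ∨ z = b) ha (.inl rfl) ?_ ?_ hc
        · rintro z w hw (rfl | rfl)
          · exact .inr (hw.right_unique h)
          · exact .inl (hw.right_unique hy)
        · rintro z w hw (rfl | rfl)
          · exact .inr (hw.left_unique hy)
          · exact .inl (hw.left_unique h)
      grind
    · exact absurd (h.left_unique hy) hab
    · exact hy
  refine ⟨hbc', ?_⟩
  obtain ⟨z, hz⟩ := R.exists_turn hc
  have hzu : G.Adj u z := hz.2.1
  rcases (hu z).1 hzu with rfl | rfl | rfl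
  · exact hz
  · exact absurd (h.left_unique hz) hac
  · exact absurd (hbc'.left_unique hz) hbc

theorem turn_or_turn {u a b c : V} (hab : a ≠ b) (hac : a ≠ c) (hbc : b ≠ c)
    (hu : ∀ x, G.Adj u x ↔ x = a ∨ x = b ∨ x = c) : R.Turn u a b ∨ R.Turn u a c := by
  have ha := (hu a).2 (by simp)
  have hb := (hu b).2 (by simp)
  obtain ⟨y, hy⟩ := R.exists_turn ha
  rcases (hu y).1 hy.2.1 with rfl | rfl | rfl
  · exfalso
    refine hab.symm (R.turn_induction (P := fun z => z = y) ha rfl ?_ ?_ hb)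
    · rintro z w hw rfl; exact hw.right_unique hy
    · rintro z w hw rfl; exact hw.left_unique hy
  · exact .inl hy
  · exact .inr hy

end RotationSystem

/-! ### The rim of a Halin graph -/

/-- The cycle `C` runs from `x` to `y`. -/
def RimStep {G : SimpleGraph V} {r : V} (C : G.Walk r r) (x y : V) : Prop :=
  ∃ h : G.Adj x y, (⟨(x, y), h⟩ : G.Dart) ∈ C.darts

namespace IsHalin

variable {G T : SimpleGraph V} {r : V} {C : G.Walk r r}

/-- Two adjacent leaves would be the whole tree, leaving too few vertices for a cycle. -/
theorem not_adj_of_leaf (H : IsHalin G T C) {x y : V} (hx : deg T x = 1) (hy : deg T y = 1) :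
    ¬ T.Adj x y := by
  classical
  intro hxy
  have nbr : ∀ a b, deg T a = 1 → T.Adj a b → ∀ z, T.Adj a z → z = b := by
    intro a b ha hab z hz
    obtain ⟨c, hc⟩ := Set.ncard_eq_one.1 ha
    have h₁ : b ∈ T.neighborSet a := hab
    have h₂ : z ∈ T.neighborSet a := hz
    rw [hc] at h₁ h₂
    exact h₂.trans h₁.symm
  have all : ∀ v, v = x ∨ v = y := by
    intro v
    obtain ⟨p⟩ := H.isTree.connected.preconnected x v
    have : ∀ (a b : V) (p : T.Walk a b), a = x ∨ a = y → b = x ∨ b = y := by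
      intro a b p
      induction p with
      | nil => exact id
      | cons h p ih =>
        rintro (rfl | rfl)
        · exact ih (.inr (nbr _ _ hx hxy _ h))
        · exact ih (.inl (nbr _ _ hy hxy.symm _ h))
    exact this x v p (.inl rfl)
  have h₁ := H.isCycle.three_le_length
  have h₂ := List.toFinset_card_of_nodup H.isCycle.support_nodup
  have h₃ : C.support.tail.toFinset ⊆ {x, y} := fun v _ => by simpa using all v
  have h₄ := (Finset.card_le_card h₃).trans Finset.card_le_two
  have h₅ : C.support.tail.length = C.length := by simp
  omega

theorem rimStep_leaf (H : IsHalin G T C) {x y : V} (h : RimStep C x y) :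
    deg T x = 1 ∧ deg T y = 1 := by
  obtain ⟨hxy, hd⟩ := h
  exact ⟨(H.mem_cycle x).1 (C.dart_fst_mem_support_of_mem_darts hd),
    (H.mem_cycle y).1 (C.dart_snd_mem_support_of_mem_darts hd)⟩

theorem mem_tail_support (H : IsHalin G T C) {x : V} (h : deg T x = 1) : x ∈ C.support.tail := by
  rcases C.mem_support_iff.1 ((H.mem_cycle x).2 h) with rfl | h'
  · exact SimpleGraph.Walk.end_mem_tail_support H.isCycle.not_nil
  · exact h'

theorem exists_rimStep_right (H : IsHalin G T C) {x : V} (h : deg T x = 1) : ∃ y, RimStep C x y := by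
  have : x ∈ C.support.dropLast := by
    rw [← C.tail_support_perm_dropLast_support.mem_iff]
    exact H.mem_tail_support h
  rw [← SimpleGraph.Walk.map_fst_darts, List.mem_map] at this
  obtain ⟨⟨⟨a, b⟩, hab⟩, hd, rfl⟩ := this
  exact ⟨b, hab, hd⟩

theorem exists_rimStep_left (H : IsHalin G T C) {x : V} (h : deg T x = 1) : ∃ y, RimStep C y x := by
  have : x ∈ C.support.tail := H.mem_tail_support h
  rw [← SimpleGraph.Walk.map_snd_darts, List.mem_map] at this
  obtain ⟨⟨⟨a, b⟩, hab⟩, hd, rfl⟩ := this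
  exact ⟨a, hab, hd⟩

theorem rimStep_right_unique (H : IsHalin G T C) {x y z : V} (h : RimStep C x y)
    (h' : RimStep C x z) : y = z := by
  have hn := H.isCycle.nodup_dropLast_support
  rw [← SimpleGraph.Walk.map_fst_darts] at hn
  have := List.inj_on_of_nodup_map hn h.2 h'.2 rfl
  simp only [SimpleGraph.Dart.mk.injEq, Prod.mk.injEq] at this
  exact this.2

theorem rimStep_left_unique (H : IsHalin G T C) {x y z : V} (h : RimStep C y x)
    (h' : RimStep C z x) : y = z := by
  have hn := H.isCycle.support_nodup
  rw [← SimpleGraph.Walk.map_snd_darts] at hn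
  have := List.inj_on_of_nodup_map hn h.2 h'.2 rfl
  simp only [SimpleGraph.Dart.mk.injEq, Prod.mk.injEq] at this
  exact this.1

theorem rimStep_asymm (H : IsHalin G T C) {x y : V} (h : RimStep C x y) : ¬ RimStep C y x := by
  intro h'
  have hn := H.isCycle.edges_nodup
  have := List.inj_on_of_nodup_map hn h.2 h'.2 Sym2.eq_swap
  simp only [SimpleGraph.Dart.mk.injEq, Prod.mk.injEq] at this
  exact h.1.ne this.1

theorem mem_edges_iff {x y : V} : s(x, y) ∈ C.edges ↔ RimStep C x y ∨ RimStep C y x := by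
  unfold SimpleGraph.Walk.edges
  rw [List.mem_map]
  constructor
  · rintro ⟨⟨⟨a, b⟩, hab⟩, hd, he⟩
    rw [SimpleGraph.Dart.edge_mk, Sym2.eq_iff] at he
    rcases he with ⟨rfl, rfl⟩ | ⟨rfl, rfl⟩
    · exact .inl ⟨hab, hd⟩
    · exact .inr ⟨hab, hd⟩
  · rintro (⟨h, hd⟩ | ⟨h, hd⟩)
    · exact ⟨_, hd, rfl⟩
    · exact ⟨_, hd, Sym2.eq_swap⟩

theorem adj_iff (H : IsHalin G T C) {x y : V} :
    G.Adj x y ↔ T.Adj x y ∨ RimStep C x y ∨ RimStep C y x := by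
  rw [← mem_edges_iff, ← SimpleGraph.mem_edgeSet, H.union, SimpleGraph.mem_edgeSet]

theorem rimStep_not_adj (H : IsHalin G T C) {x y : V} (h : RimStep C x y) : ¬ T.Adj x y :=
  H.not_adj_of_leaf (H.rimStep_leaf h).1 (H.rimStep_leaf h).2

/-- The tree contributes `|V| - 1` edges and the cycle `|C|`; they are disjoint because edges of `C`
join leaves. -/
theorem ncard_edgeSet [Finite V] (H : IsHalin G T C) :
    G.edgeSet.ncard + 1 = Nat.card V + C.length := by
  classical
  have := Fintype.ofFinite V
  have hU : G.edgeSet = T.edgeSet ∪ (C.edges.toFinset : Set (Sym2 V)) := by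
    ext e
    rw [H.union, Set.mem_union, Finset.mem_coe, List.mem_toFinset]
  have hD : Disjoint T.edgeSet (C.edges.toFinset : Set (Sym2 V)) := by
    rw [Set.disjoint_left]
    intro e
    induction e with | _ x y
    rw [Finset.mem_coe, List.mem_toFinset, mem_edges_iff, SimpleGraph.mem_edgeSet]
    rintro h (h' | h')
    · exact H.rimStep_not_adj h' h
    · exact H.rimStep_not_adj h' h.symm
  rw [hU, Set.ncard_union_eq hD (Set.toFinite _) (Set.toFinite _), Set.ncard_coe_finset,
    List.toFinset_card_of_nodup H.isCycle.edges_nodup, SimpleGraph.Walk.length_edges,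
    Nat.card_eq_fintype_card, ← H.isTree.card_edgeFinset, ← SimpleGraph.coe_edgeFinset,
    Set.ncard_coe_finset]
  omega

/-- If every dart outside `C` lies in the face of a reversed dart of `C`, then by Euler's formula no two
reversed darts of `C` lie in the same face. -/
theorem eq_of_sameCycle_symm [Finite V] (H : IsHalin G T C) {R : RotationSystem G} (hR : R.IsPlane)
    {d₀ : G.Dart} (hd₀ : ∀ d : G.Dart, d ∈ C.darts ↔ R.faceMap.SameCycle d₀ d)
    (hits : ∀ d, d ∉ C.darts → ∃ c ∈ C.darts, R.faceMap.SameCycle d c.symm)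
    {c c' : G.Dart} (hc : c ∈ C.darts) (hc' : c' ∈ C.darts)
    (h : R.faceMap.SameCycle c.symm c'.symm) : c = c' := by
  classical
  have hnd : C.darts.Nodup := (List.Nodup.of_map _ H.isCycle.edges_nodup)
  let Φ : Option {d : G.Dart // d ∈ C.darts.toFinset} → R.Face := fun o =>
    Quotient.mk (Equiv.Perm.SameCycle.setoid R.faceMap) (o.elim d₀ fun d => d.1.symm)
  have hsurj : Function.Surjective Φ := by
    rintro ⟨d⟩
    by_cases hd : d ∈ C.darts
    · exact ⟨none, Quotient.sound ((hd₀ d).1 hd)⟩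
    · obtain ⟨c, hc, hs⟩ := hits d hd
      exact ⟨some ⟨c, List.mem_toFinset.2 hc⟩, Quotient.sound hs.symm⟩
  -- The edge count and Euler's formula give `|C| + 1` faces, as many as the domain of `Φ` has
  -- elements, so the surjection `Φ` is also injective.
  have hcard : Nat.card (Option {d : G.Dart // d ∈ C.darts.toFinset}) ≤ Nat.card R.Face := by
    have h₁ := hR.2
    have h₂ := H.ncard_edgeSet
    rw [Nat.card_eq_fintype_card, Fintype.card_option, Fintype.card_coe,
      List.toFinset_card_of_nodup hnd, SimpleGraph.Walk.length_darts]
    omega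
  have hinj := (hsurj.bijective_of_nat_card_le hcard).1
  have := @hinj (some ⟨c, List.mem_toFinset.2 hc⟩) (some ⟨c', List.mem_toFinset.2 hc'⟩)
    (Quotient.sound h)
  simpa using this

/-- The darts of `C` form a full cycle of the face map, so the dart following `(x, y)` on its face
is again in `C`. -/
theorem rimStep_turn (H : IsHalin G T C) {R : RotationSystem G} {d₀ : G.Dart}
    (hd₀ : ∀ d : G.Dart, d ∈ C.darts ↔ R.faceMap.SameCycle d₀ d) {x y z : V} (h : RimStep C x y)
    (h' : RimStep C y z) : R.Turn y x z := by
  obtain ⟨w, hw⟩ := R.exists_turn h.1.symm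
  obtain ⟨h₁, h₂, hs⟩ := hw.sameFace
  have : RimStep C y w := ⟨h₂, (hd₀ _).2 (((hd₀ _).1 h.2).trans hs)⟩
  rwa [H.rimStep_right_unique h' this]

/-- The neighbors of a leaf `y` of the tree. -/
theorem adj_leaf_iff (H : IsHalin G T C) {x y z t : V} (h : RimStep C x y) (h' : RimStep C y z)
    (ht : T.Adj y t) : x ≠ z ∧ x ≠ t ∧ z ≠ t ∧ ∀ u, G.Adj y u ↔ u = x ∨ u = z ∨ u = t := by
  have hy := (H.rimStep_leaf h).2
  refine ⟨?_, ?_, ?_, fun u => ?_⟩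
  · rintro rfl; exact H.rimStep_asymm h h'
  · rintro rfl; exact H.rimStep_not_adj h ht.symm
  · rintro rfl; exact H.rimStep_not_adj h' ht
  · rw [H.adj_iff]
    constructor
    · rintro (hu | hu | hu)
      · obtain ⟨c, hc⟩ := Set.ncard_eq_one.1 hy
        have h₁ : t ∈ T.neighborSet y := ht
        have h₂ : u ∈ T.neighborSet y := hu
        rw [hc] at h₁ h₂
        exact .inr (.inr (h₂.trans h₁.symm))
      · exact .inr (.inl (H.rimStep_right_unique hu h'))
      · exact .inl (H.rimStep_left_unique hu h)
    · rintro (rfl | rfl | rfl)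
      exacts [.inr (.inr h), .inr (.inl h'), .inl ht]

/-- If the facial walk entering the tree at the leaf `x` leaves it at the leaf `z`, then `z` follows `x` on
the cycle. -/
theorem rimStep_of_sameFace [Finite V] (H : IsHalin G T C) {R : RotationSystem G} (hR : R.IsPlane)
    {d₀ : G.Dart} (hd₀ : ∀ d : G.Dart, d ∈ C.darts ↔ R.faceMap.SameCycle d₀ d)
    (hits : ∀ x y, T.Adj x y → ∃ z t, deg T z = 1 ∧ T.Adj t z ∧ R.SameFace x y t z)
    {x t t' z : V} (hx : deg T x = 1) (hz : deg T z = 1) (hxt : T.Adj x t) (htz : T.Adj t' z)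
    (hs : R.SameFace x t t' z) : RimStep C x z := by
  -- At a leaf the rotation is predecessor, successor, tree neighbor. Hence the reversed rim dart
  -- into `x` is followed by the tree edge, and in `leave` the tree edge into `z` is followed by a
  -- reversed rim dart.
  have enter : ∀ {x q t : V}, RimStep C x q → T.Adj x t → R.SameFace q x x t := by
    intro x q t hq ht
    obtain ⟨p, hp⟩ := H.exists_rimStep_left (H.rimStep_leaf hq).1
    obtain ⟨h₁, h₂, h₃, h₄⟩ := H.adj_leaf_iff hp hq ht
    exact ((H.rimStep_turn hd₀ hp hq).cyclic h₁ h₂ h₃ h₄).1.sameFace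
  have leave : ∀ {p z t : V}, RimStep C p z → T.Adj t z → R.SameFace t z z p := by
    intro p z t hp ht
    obtain ⟨q, hq⟩ := H.exists_rimStep_right (H.rimStep_leaf hp).2
    obtain ⟨h₁, h₂, h₃, h₄⟩ := H.adj_leaf_iff hp hq ht.symm
    exact ((H.rimStep_turn hd₀ hp hq).cyclic h₁ h₂ h₃ h₄).2.sameFace
  obtain ⟨q, hq⟩ := H.exists_rimStep_right hx
  obtain ⟨p, hp⟩ := H.exists_rimStep_left hz
  -- The reversals of `(x, q)` and `(p, z)` share a face, so these two rim darts coincide.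
  obtain ⟨a, b, hab⟩ := ((enter hq hxt).trans hs).trans (leave hp htz)
  have hits' : ∀ d, d ∉ C.darts → ∃ c ∈ C.darts, R.faceMap.SameCycle d c.symm := by
    rintro ⟨⟨x, y⟩, hxy⟩ hd
    rcases H.adj_iff.1 hxy with h | h | h
    · obtain ⟨z, t, hz, ht, hface⟩ := hits x y h
      obtain ⟨p, hp⟩ := H.exists_rimStep_left hz
      obtain ⟨_, h', hs'⟩ := hface.trans (leave hp ht)
      exact ⟨⟨(p, z), hp.1⟩, hp.2, hs'⟩
    · exact absurd h.2 hd
    · exact ⟨⟨(y, x), h.1⟩, h.2, .rfl⟩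
  have := H.eq_of_sameCycle_symm hR hd₀ hits' hq.2 hp.2 hab
  simp only [SimpleGraph.Dart.mk.injEq, Prod.mk.injEq] at this
  rwa [this.2] at hq

end IsHalin

end HalinStar

/-! ### Cubic caterpillars as combs -/

namespace HalinStar
variable {V : Type*}

/-- A cubic caterpillar as a path `w 0, …, w (n + 1)` joining two leaves, with a further leaf `l i` attached
to each inner vertex `w i`. -/
structure IsComb (T : SimpleGraph V) (n : ℕ) (w l : ℕ → V) : Prop where
  pos : 1 ≤ n
  adj : ∀ i < n, ∀ x, T.Adj (w (i + 1)) x ↔ x = w i ∨ x = w (i + 2) ∨ x = l (i + 1)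
  ne : ∀ i < n, w i ≠ w (i + 2) ∧ w i ≠ l (i + 1) ∧ w (i + 2) ≠ l (i + 1)
  injOn : ∀ i j, i ≤ n + 1 → j ≤ n + 1 → w i = w j → i = j
  deg_zero : deg T (w 0) = 1
  deg_last : deg T (w (n + 1)) = 1
  deg_leaf : ∀ i < n, deg T (l (i + 1)) = 1
  deg_inner : ∀ i < n, deg T (w (i + 1)) ≠ 1
  cover : ∀ x, (∃ i ≤ n + 1, x = w i) ∨ ∃ i < n, x = l (i + 1)

theorem eq_of_deg_eq_one {T : SimpleGraph V} {x y z : V} (hx : deg T x = 1) (hy : T.Adj x y)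
    (hz : T.Adj x z) : y = z := by
  obtain ⟨c, hc⟩ := Set.ncard_eq_one.1 hx
  have h₁ : y ∈ T.neighborSet x := hy
  have h₂ : z ∈ T.neighborSet x := hz
  rw [hc] at h₁ h₂
  exact h₁.trans h₂.symm

theorem exists_adj_of_deg_eq_one {T : SimpleGraph V} {x : V} (hx : deg T x = 1) : ∃ y, T.Adj x y := by
  obtain ⟨c, hc⟩ := Set.ncard_eq_one.1 hx
  have h₁ : c ∈ T.neighborSet x := by rw [hc]; rfl
  exact ⟨c, h₁⟩

/-- The spine of a cubic caterpillar Halin graph as a sequence. -/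
theorem exists_spine {T : SimpleGraph V} [Nonempty V] {n : ℕ}
    (e : T.induce {v | deg T v ≠ 1} ≃g SimpleGraph.pathGraph n) :
    ∃ sp : ℕ → V, (∀ k < n, deg T (sp k) ≠ 1) ∧
      (∀ j k, j < n → k < n → (T.Adj (sp j) (sp k) ↔ j + 1 = k ∨ k + 1 = j)) ∧
      (∀ j k, j < n → k < n → sp j = sp k → j = k) ∧
      ∀ x, deg T x ≠ 1 → ∃ k < n, x = sp k := by
  classical
  refine ⟨fun k => if h : k < n then (e.symm ⟨k, h⟩).1 else Classical.arbitrary V, ?_, ?_, ?_, ?_⟩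
  · intro k hk
    simp only [hk, dif_pos]
    exact (e.symm ⟨k, hk⟩).2
  · intro j k hj hk
    simp only [hj, hk, dif_pos]
    have := e.symm.map_adj_iff (v := ⟨j, hj⟩) (w := ⟨k, hk⟩)
    rw [SimpleGraph.pathGraph_adj] at this
    exact this
  · intro j k hj hk h
    simp only [hj, hk, dif_pos] at h
    have := e.symm.injective (Subtype.ext h)
    simpa using this
  · intro x hx
    refine ⟨(e ⟨x, hx⟩).1, (e ⟨x, hx⟩).2, ?_⟩
    simp

theorem IsCubicHalin.exists_comb {G T : SimpleGraph V} {r : V} {C : G.Walk r r}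
    (H : IsCubicHalin G T C) (hT : IsCaterpillar T) : ∃ n w l, IsComb T n w l := by
  classical
  have : Nonempty V := ⟨r⟩
  obtain ⟨-, n, ⟨e⟩⟩ := hT
  obtain ⟨sp, hdeg, hadj, hinj, hcov⟩ := exists_spine e
  have leaf := fun x y => H.isHalin.not_adj_of_leaf (x := x) (y := y)
  have triple : ∀ x, deg T x ≠ 1 → ∃ a b c, a ≠ b ∧ a ≠ c ∧ b ≠ c ∧
      ∀ y, T.Adj x y ↔ y = a ∨ y = b ∨ y = c := by
    intro x hx
    obtain ⟨a, b, c, hab, hac, hbc, h⟩ := Set.ncard_eq_three.1 (H.deg_eq_three x hx)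
    refine ⟨a, b, c, hab, hac, hbc, fun y => ?_⟩
    rw [← SimpleGraph.mem_neighborSet, h]
    simp
  have hn : 1 ≤ n := by
    by_contra hn
    have all : ∀ x, deg T x = 1 := by
      intro x
      by_contra hx
      obtain ⟨k, hk, -⟩ := hcov x hx
      omega
    obtain ⟨y, hy⟩ := exists_adj_of_deg_eq_one (all r)
    exact leaf r y (all r) (all y) hy
  -- The first spine vertex has three neighbors and at most one of them on the spine.
  obtain ⟨w₀, hw₀, hw₀'⟩ : ∃ x, T.Adj (sp 0) x ∧ deg T x = 1 := by
    obtain ⟨a, b, c, hab, hac, hbc, h⟩ := triple (sp 0) (hdeg 0 hn)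
    by_contra! hcon
    have key : ∀ x, T.Adj (sp 0) x → x = sp 1 := by
      intro x hx
      obtain ⟨k, hk, rfl⟩ := hcov x (hcon x hx)
      have := (hadj 0 k hn hk).1 hx
      congr 1; omega
    exact hab ((key a ((h a).2 (by simp))).trans (key b ((h b).2 (by simp))).symm)
  -- Distinctness from `w₀` matters when the spine is a single vertex: both end leaves then hang on
  -- it. If no such leaf existed, all neighbors would equal the vertex named in `key`.
  obtain ⟨w₁, hw₁, hw₁', hne⟩ : ∃ x, T.Adj (sp (n - 1)) x ∧ deg T x = 1 ∧ x ≠ w₀ := by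
    obtain ⟨a, b, c, hab, hac, hbc, h⟩ := triple (sp (n - 1)) (hdeg _ (by omega))
    by_contra! hcon
    have key : ∀ x, T.Adj (sp (n - 1)) x → x = if n = 1 then w₀ else sp (n - 2) := by
      intro x hx
      by_cases hx1 : deg T x = 1
      · obtain rfl := hcon x hx hx1
        have := hinj _ _ (by omega) (by omega) (eq_of_deg_eq_one hx1 hx.symm hw₀.symm)
        rw [if_pos (by omega)]
      · obtain ⟨k, hk, rfl⟩ := hcov x hx1
        have := (hadj (n - 1) k (by omega) hk).1 hx
        rw [if_neg (by omega)]
        congr 1; omega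
    exact hab ((key a ((h a).2 (by simp))).trans (key b ((h b).2 (by simp))).symm)
  let w : ℕ → V := fun k => if k = 0 then w₀ else if k ≤ n then sp (k - 1) else w₁
  have w_zero : w 0 = w₀ := rfl
  have w_succ : ∀ k < n, w (k + 1) = sp k := by
    intro k hk
    simp only [w]
    rw [if_neg (by omega), if_pos (by omega), Nat.add_sub_cancel]
  have w_last : w (n + 1) = w₁ := by
    simp only [w]
    rw [if_neg (by omega), if_neg (by omega)]
  have prev : ∀ i < n, T.Adj (w (i + 1)) (w i) := by
    intro i hi
    rw [w_succ i hi]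
    rcases Nat.eq_zero_or_pos i with rfl | hi0
    · exact hw₀
    · obtain ⟨j, rfl⟩ : ∃ j, i = j + 1 := ⟨i - 1, by omega⟩
      rw [w_succ j (by omega)]
      exact (hadj _ _ hi (by omega)).2 (.inr rfl)
  have next : ∀ i < n, T.Adj (w (i + 1)) (w (i + 2)) := by
    intro i hi
    rw [w_succ i hi]
    rcases Nat.lt_or_ge (i + 1) n with hi1 | hi1
    · rw [w_succ (i + 1) hi1]
      exact (hadj _ _ hi hi1).2 (.inl rfl)
    · obtain rfl : n = i + 1 := by omega
      rw [w_last]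
      exact hw₁
  have w_inj : ∀ i j, i ≤ n + 1 → j ≤ n + 1 → w i = w j → i = j := by
    have key : ∀ i j, i < j → j ≤ n + 1 → w i ≠ w j := by
      intro i j hij hj h
      rcases Nat.lt_or_ge n j with hjn | hjn
      · obtain rfl : j = n + 1 := by omega
        rw [w_last] at h
        rcases Nat.eq_zero_or_pos i with rfl | hi
        · exact hne h.symm
        · obtain ⟨i, rfl⟩ : ∃ k, i = k + 1 := ⟨i - 1, by omega⟩
          rw [w_succ i (by omega)] at h
          exact hdeg i (by omega) (h ▸ hw₁')
      · obtain ⟨j, rfl⟩ : ∃ k, j = k + 1 := ⟨j - 1, by omega⟩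
        rw [w_succ j (by omega)] at h
        rcases Nat.eq_zero_or_pos i with rfl | hi
        · exact hdeg j (by omega) (h ▸ hw₀')
        · obtain ⟨i, rfl⟩ : ∃ k, i = k + 1 := ⟨i - 1, by omega⟩
          rw [w_succ i (by omega)] at h
          have := hinj _ _ (by omega) (by omega) h
          omega
    intro i j hi hj h
    rcases lt_trichotomy i j with hlt | heq | hlt
    · exact absurd h (key i j hlt hj)
    · exact heq
    · exact absurd h.symm (key j i hlt hi)
  have third : ∀ i, ∃ z, i < n → w i ≠ z ∧ w (i + 2) ≠ z ∧
      ∀ u, T.Adj (w (i + 1)) u ↔ u = w i ∨ u = w (i + 2) ∨ u = z := by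
    intro i
    by_cases hi : i < n
    · obtain ⟨a, b, c, hab, hac, hbc, h⟩ := triple (w (i + 1)) (by rw [w_succ i hi]; exact hdeg i hi)
      obtain ⟨z, h₁, h₂, h₃⟩ := exists_third_of_triple hab hac hbc ((h _).1 (prev i hi))
        ((h _).1 (next i hi)) fun h => by have := w_inj _ _ (by omega) (by omega) h; omega
      exact ⟨z, fun _ => ⟨h₁, h₂, fun u => (h u).trans (h₃ u)⟩⟩
    · exact ⟨r, fun h => absurd h hi⟩
  choose z hz using third
  refine ⟨n, w, fun i => z (i - 1), hn, fun i hi => (hz i hi).2.2,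
    fun i hi => ⟨fun h => ?_, (hz i hi).1, (hz i hi).2.1⟩, w_inj, hw₀', by rw [w_last]; exact hw₁', ?_,
    fun i hi => by rw [w_succ i hi]; exact hdeg i hi, ?_⟩
  · have := w_inj _ _ (by omega) (by omega) h
    omega
  -- A third neighbor that is not a leaf would be next to `w (i + 1)` on the spine, hence equal to
  -- `w i` or `w (i + 2)`.
  · intro i hi
    by_contra hcon
    simp only [Nat.add_sub_cancel] at hcon
    obtain ⟨k, hk, hk'⟩ := hcov _ hcon
    have h := ((hz i hi).2.2 (z i)).2 (by simp)
    rw [hk', w_succ i hi, hadj _ _ hi hk] at h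
    rcases h with rfl | rfl
    · exact (hz i hi).2.1 (by rw [hk', w_succ _ hk])
    · exact (hz (k + 1) hi).1 (by rw [hk', w_succ _ hk])
  · intro x
    by_cases hx : deg T x = 1
    · obtain ⟨y, hy⟩ := exists_adj_of_deg_eq_one hx
      obtain ⟨k, hk, rfl⟩ := hcov y fun hy1 => leaf x y hx hy1 hy
      rw [← w_succ k hk] at hy
      rcases ((hz k hk).2.2 x).1 hy.symm with h | h | h
      · exact .inl ⟨k, by omega, h⟩
      · exact .inl ⟨k + 2, by omega, h⟩
      · exact .inr ⟨k, hk, h⟩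
    · obtain ⟨k, hk, rfl⟩ := hcov x hx
      exact .inl ⟨k + 1, by omega, (w_succ k hk).symm⟩

namespace IsComb

variable {T : SimpleGraph V} {n : ℕ} {w l : ℕ → V}

theorem adj_prev (h : IsComb T n w l) {i : ℕ} (hi : i < n) : T.Adj (w (i + 1)) (w i) :=
  (h.adj i hi _).2 (.inl rfl)

theorem adj_next (h : IsComb T n w l) {i : ℕ} (hi : i < n) : T.Adj (w (i + 1)) (w (i + 2)) :=
  (h.adj i hi _).2 (.inr (.inl rfl))

theorem adj_leaf (h : IsComb T n w l) {i : ℕ} (hi : i < n) : T.Adj (w (i + 1)) (l (i + 1)) :=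
  (h.adj i hi _).2 (.inr (.inr rfl))

theorem adj_succ (h : IsComb T n w l) {i : ℕ} (hi : i ≤ n) : T.Adj (w i) (w (i + 1)) := by
  rcases Nat.lt_or_ge i n with hin | hin
  · exact (h.adj_prev hin).symm
  · have := h.pos
    obtain ⟨j, rfl⟩ : ∃ j, i = j + 1 := ⟨i - 1, by omega⟩
    exact h.adj_next (by omega)

theorem leaf_inj (h : IsComb T n w l) {i j : ℕ} (hi : i < n) (hj : j < n)
    (hij : l (i + 1) = l (j + 1)) : i = j := by
  have h₁ := (h.adj_leaf hi).symm
  have h₂ := (h.adj_leaf hj).symm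
  rw [← hij] at h₂
  have := h.injOn _ _ (by omega) (by omega) (eq_of_deg_eq_one (h.deg_leaf i hi) h₁ h₂)
  omega

theorem leaf_ne (h : IsComb T n w l) {i j : ℕ} (hi : i < n) (hj : j ≤ n + 1) : l (i + 1) ≠ w j := by
  intro he
  have hpos := h.pos
  have hl := h.deg_leaf i hi
  have ha := (h.adj_leaf hi).symm
  rcases Nat.eq_zero_or_pos j with rfl | hj0
  · rw [he] at ha
    have h₁ := eq_of_deg_eq_one h.deg_zero ha (h.adj_prev hpos).symm
    have h₂ := h.injOn _ _ (by omega) (by omega) h₁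
    obtain rfl : i = 0 := by omega
    exact (h.ne 0 hi).2.1 he.symm
  · rcases Nat.lt_or_ge n j with hjn | hjn
    · obtain rfl : j = n + 1 := by omega
      rw [he] at ha
      have h₁ := eq_of_deg_eq_one h.deg_last ha (h.adj_succ le_rfl).symm
      have h₂ := h.injOn _ _ (by omega) (by omega) h₁
      subst h₂
      exact (h.ne i hi).2.2 he.symm
    · obtain ⟨j, rfl⟩ : ∃ k, j = k + 1 := ⟨j - 1, by omega⟩
      exact h.deg_inner j (by omega) (he ▸ hl)

end IsComb

end HalinStar

/-! ### Tracing the faces: the cycle runs along the two rails -/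

namespace HalinStar
variable {V : Type*}

/-- The vertex of the comb in a given position. -/
def place (w l : ℕ → V) : Option Bool × ℕ → V
  | (none, i) => w i
  | (some _, i) => l i

/-- The positions which are occupied. -/
def Valid (n : ℕ) (s : ℕ → Bool) (p : Option Bool × ℕ) : Prop :=
  (p.1 = none ∧ p.2 ≤ n + 1) ∨ (p.1 = some (s p.2) ∧ 1 ≤ p.2 ∧ p.2 ≤ n)

theorem OnStrand.valid {n : ℕ} {s : ℕ → Bool} {σ : Option Bool} {i : ℕ} (h : OnStrand n s σ i)
    (hi : i ≤ n + 1) : Valid n s (node n σ i) := by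
  unfold node Valid
  unfold OnStrand at h
  split_ifs with h₁
  · exact .inl ⟨rfl, hi⟩
  · push Not at h₁
    rcases h with h | h | h | h
    · exact absurd h h₁.1
    · exact absurd h h₁.2
    · exact .inl ⟨h, hi⟩
    · exact .inr ⟨h, by change 1 ≤ i; omega, by change i ≤ n; omega⟩

theorem Link.valid {n : ℕ} {s : ℕ → Bool} {p q : Option Bool × ℕ} (h : Link n s p q) :
    Valid n s p ∧ Valid n s q := by
  rcases h with ⟨σ, j, k, h⟩ | ⟨i, h₁, h₂⟩
  · exact ⟨h.left.valid (h.lt.le.trans h.le), h.right.valid h.le⟩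
  · exact ⟨.inl ⟨rfl, by change i ≤ n + 1; omega⟩, .inr ⟨rfl, h₁, h₂⟩⟩

theorem IsComb.place_injOn {T : SimpleGraph V} {n : ℕ} {w l : ℕ → V} (h : IsComb T n w l)
    {s : ℕ → Bool} {p q : Option Bool × ℕ} (hp : Valid n s p) (hq : Valid n s q)
    (hpq : place w l p = place w l q) : p = q := by
  obtain ⟨σ, i⟩ := p
  obtain ⟨τ, j⟩ := q
  unfold Valid at hp hq
  simp only at hp hq
  rcases hp with ⟨rfl, hi⟩ | ⟨rfl, hi, hi'⟩ <;> rcases hq with ⟨rfl, hj⟩ | ⟨rfl, hj, hj'⟩ <;>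
    simp only [place] at hpq
  · rw [h.injOn i j hi hj hpq]
  · obtain ⟨j, rfl⟩ : ∃ k, j = k + 1 := ⟨j - 1, by omega⟩
    exact absurd hpq.symm (h.leaf_ne hj' hi)
  · obtain ⟨i, rfl⟩ : ∃ k, i = k + 1 := ⟨i - 1, by omega⟩
    exact absurd hpq (h.leaf_ne hi' hj)
  · obtain ⟨i, rfl⟩ : ∃ k, i = k + 1 := ⟨i - 1, by omega⟩
    obtain ⟨j, rfl⟩ : ∃ k, j = k + 1 := ⟨j - 1, by omega⟩
    rw [h.leaf_inj hi' hj' hpq]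

/-- The rotation at the inner vertices of the spine: the leaf of `w i` lies behind `w (i - 1)` if `s i` is
true and behind `w (i + 1)` otherwise. -/
structure HasSides {G : SimpleGraph V} (R : RotationSystem G) (n : ℕ) (w l : ℕ → V) (s : ℕ → Bool) :
    Prop where
  of_true : ∀ i < n, s (i + 1) = true → R.Turn (w (i + 1)) (w i) (l (i + 1)) ∧
    R.Turn (w (i + 1)) (l (i + 1)) (w (i + 2)) ∧ R.Turn (w (i + 1)) (w (i + 2)) (w i)
  of_false : ∀ i < n, s (i + 1) = false → R.Turn (w (i + 1)) (w i) (w (i + 2)) ∧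
    R.Turn (w (i + 1)) (w (i + 2)) (l (i + 1)) ∧ R.Turn (w (i + 1)) (l (i + 1)) (w i)

section Halin

variable {G T : SimpleGraph V} {r : V} {C : G.Walk r r} {n : ℕ} {w l : ℕ → V} {s : ℕ → Bool}
  {R : RotationSystem G}

theorem IsHalin.adj_inner_iff (H : IsHalin G T C) (h : IsComb T n w l) {i : ℕ} (hi : i < n) (x : V) :
    G.Adj (w (i + 1)) x ↔ x = w i ∨ x = w (i + 2) ∨ x = l (i + 1) := by
  rw [H.adj_iff, h.adj i hi]
  refine ⟨fun hx => ?_, .inl⟩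
  rcases hx with hx | hx | hx
  · exact hx
  · exact absurd (H.rimStep_leaf hx).1 (h.deg_inner i hi)
  · exact absurd (H.rimStep_leaf hx).2 (h.deg_inner i hi)

theorem IsHalin.exists_sides (H : IsHalin G T C) (h : IsComb T n w l) (R : RotationSystem G) :
    ∃ s, HasSides R n w l s := by
  classical
  refine ⟨fun i => decide (R.Turn (w i) (w (i - 1)) (l i)), fun i hi hs => ?_, fun i hi hs => ?_⟩
  · obtain ⟨h₁, h₂, h₃⟩ := h.ne i hi
    have ht : R.Turn (w (i + 1)) (w i) (l (i + 1)) := by simpa using hs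
    refine ⟨ht, ht.cyclic h₂ h₁ h₃.symm fun x => ?_⟩
    rw [H.adj_inner_iff h hi]
    tauto
  · obtain ⟨h₁, h₂, h₃⟩ := h.ne i hi
    have ht : ¬ R.Turn (w (i + 1)) (w i) (l (i + 1)) := by simpa using hs
    have ht' := (R.turn_or_turn h₁ h₂ h₃ (H.adj_inner_iff h hi)).resolve_right ht
    exact ⟨ht', ht'.cyclic h₁ h₂ h₃ (H.adj_inner_iff h hi)⟩

/-- The facial walk which follows the spine to the right. -/
theorem IsHalin.exists_face_right (H : IsHalin G T C) (h : IsComb T n w l) (hs : HasSides R n w l s) :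
    ∀ d i, i + d = n → ∃ k, i < k ∧ k ≤ n + 1 ∧ OnStrand n s (some true) k ∧
      (∀ m, i < m → m < k → ¬ OnStrand n s (some true) m) ∧
      ∃ t, T.Adj t (place w l (node n (some true) k)) ∧
        R.SameFace (w i) (w (i + 1)) t (place w l (node n (some true) k)) := by
  intro d
  induction d with
  | zero =>
    rintro i rfl
    refine ⟨i + 1, by omega, by omega, .inr (.inl rfl), by intros; omega, w i, ?_, ?_⟩
    · simpa [node, place] using h.adj_succ le_rfl
    · simpa [node, place] using RotationSystem.SameFace.refl (H.adj_iff.2 (.inl (h.adj_succ le_rfl)))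
  | succ d ih =>
    intro i hid
    have hi : i < n := by omega
    cases hsi : s (i + 1) with
    -- The rotation at `w (i + 1)` decides: on side `true` the walk turns off to the leaf, otherwise
    -- it continues along the spine.
    | true =>
      refine ⟨i + 1, by omega, by omega, .inr (.inr (.inr (by rw [hsi]))), by intros; omega,
        w (i + 1), ?_, ?_⟩ <;> rw [node_of_inner _ (by omega) (by omega)]
      · exact h.adj_leaf hi
      · exact (hs.of_true i hi hsi).1.sameFace
    | false =>
      obtain ⟨k, hk, hk', hon, hbet, t, ht, hface⟩ := ih (i + 1) (by omega)
      refine ⟨k, by omega, hk', hon, fun m hm hm' => ?_, t, ht,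
        (hs.of_false i hi hsi).1.sameFace.trans hface⟩
      by_cases hmi : m = i + 1
      · subst hmi
        simp [OnStrand, hsi, hi.ne]
      · exact hbet m (by omega) hm'

/-- The facial walk which follows the spine to the left. -/
theorem IsHalin.exists_face_left (H : IsHalin G T C) (h : IsComb T n w l) (hs : HasSides R n w l s) :
    ∀ i, i ≤ n → ∃ k, k ≤ i ∧ OnStrand n s (some false) k ∧
      (∀ m, k < m → m < i + 1 → ¬ OnStrand n s (some false) m) ∧
      ∃ t, T.Adj t (place w l (node n (some false) k)) ∧
        R.SameFace (w (i + 1)) (w i) t (place w l (node n (some false) k)) := by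
  intro i
  induction i with
  | zero =>
    intro hi
    refine ⟨0, by omega, .inl rfl, by intros; omega, w 1, ?_, ?_⟩
    · simpa [node, place] using (h.adj_succ hi).symm
    · simpa [node, place] using
        RotationSystem.SameFace.refl (H.adj_iff.2 (.inl (h.adj_succ hi).symm))
  | succ i ih =>
    intro hi
    cases hsi : s (i + 1) with
    | false =>
      refine ⟨i + 1, by omega, .inr (.inr (.inr (by rw [hsi]))), by intros; omega,
        w (i + 1), ?_, ?_⟩ <;> rw [node_of_inner _ (by omega) (by omega)]
      · exact h.adj_leaf hi
      · exact (hs.of_false i hi hsi).2.1.sameFace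
    | true =>
      obtain ⟨k, hk, hon, hbet, t, ht, hface⟩ := ih (by omega)
      refine ⟨k, by omega, hon, fun m hm hm' => ?_, t, ht,
        (hs.of_true i hi hsi).2.2.sameFace.trans hface⟩
      by_cases hmi : m = i + 1
      · subst hmi
        have : i ≠ n := by omega
        simp [OnStrand, hsi, this]
      · exact hbet m hm (by omega)

theorem IsComb.deg_place (h : IsComb T n w l) {b : Bool} {k : ℕ} (hk : k ≤ n + 1) :
    deg T (place w l (node n (some b) k)) = 1 := by
  unfold node
  split_ifs with hk'
  · rcases hk' with rfl | rfl
    exacts [h.deg_zero, h.deg_last]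
  · obtain ⟨k, rfl⟩ : ∃ i, k = i + 1 := ⟨k - 1, by omega⟩
    exact h.deg_leaf k (by omega)

theorem IsComb.adj_cases (h : IsComb T n w l) (hleaf : ∀ x y, deg T x = 1 → deg T y = 1 → ¬ T.Adj x y)
    {x y : V} (hxy : T.Adj x y) :
    (∃ i ≤ n, x = w i ∧ y = w (i + 1)) ∨ (∃ i ≤ n, x = w (i + 1) ∧ y = w i) ∨
    (∃ i < n, x = w (i + 1) ∧ y = l (i + 1)) ∨ ∃ i < n, x = l (i + 1) ∧ y = w (i + 1) := by
  have inner : ∀ x, deg T x ≠ 1 → ∃ i < n, x = w (i + 1) := by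
    intro x hx
    rcases h.cover x with ⟨i, hi, rfl⟩ | ⟨i, hi, rfl⟩
    · rcases Nat.eq_zero_or_pos i with rfl | hi0
      · exact absurd h.deg_zero hx
      · obtain ⟨i, rfl⟩ : ∃ k, i = k + 1 := ⟨i - 1, by omega⟩
        refine ⟨i, ?_, rfl⟩
        by_contra hin
        obtain rfl : i = n := by omega
        exact hx h.deg_last
    · exact absurd (h.deg_leaf i hi) hx
  by_cases hx : deg T x = 1
  · obtain ⟨i, hi, rfl⟩ := inner y fun hy => hleaf x y hx hy hxy
    rcases (h.adj i hi x).1 hxy.symm with rfl | rfl | rfl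
    · exact .inl ⟨i, hi.le, rfl, rfl⟩
    · exact .inr (.inl ⟨i + 1, hi, rfl, rfl⟩)
    · exact .inr (.inr (.inr ⟨i, hi, rfl, rfl⟩))
  · obtain ⟨i, hi, rfl⟩ := inner x hx
    rcases (h.adj i hi y).1 hxy with rfl | rfl | rfl
    · exact .inr (.inl ⟨i, hi.le, rfl, rfl⟩)
    · exact .inl ⟨i + 1, hi, rfl, rfl⟩
    · exact .inr (.inr (.inl ⟨i, hi, rfl, rfl⟩))

theorem IsHalin.exists_face_leaf (H : IsHalin G T C) (h : IsComb T n w l) (hs : HasSides R n w l s)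
    {x y : V} (hxy : T.Adj x y) : ∃ z t, deg T z = 1 ∧ T.Adj t z ∧ R.SameFace x y t z := by
  have right : ∀ i ≤ n, ∃ z t, deg T z = 1 ∧ T.Adj t z ∧ R.SameFace (w i) (w (i + 1)) t z := by
    intro i hi
    obtain ⟨k, -, hk, -, -, t, ht, hf⟩ := H.exists_face_right h hs (n - i) i (by omega)
    exact ⟨_, t, h.deg_place hk, ht, hf⟩
  have left : ∀ i ≤ n, ∃ z t, deg T z = 1 ∧ T.Adj t z ∧ R.SameFace (w (i + 1)) (w i) t z := by
    intro i hi
    obtain ⟨k, hk, -, -, t, ht, hf⟩ := H.exists_face_left h hs i hi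
    exact ⟨_, t, h.deg_place (by omega), ht, hf⟩
  rcases h.adj_cases (fun _ _ => H.not_adj_of_leaf) hxy with
    ⟨i, hi, rfl, rfl⟩ | ⟨i, hi, rfl, rfl⟩ | ⟨i, hi, rfl, rfl⟩ | ⟨i, hi, rfl, rfl⟩
  · exact right i hi
  · exact left i hi
  · exact ⟨_, _, h.deg_leaf i hi, hxy, .refl (H.adj_iff.2 (.inl hxy))⟩
  · cases hsi : s (i + 1) with
    | true =>
      obtain ⟨z, t, h₁, h₂, h₃⟩ := right (i + 1) hi
      exact ⟨z, t, h₁, h₂, (hs.of_true i hi hsi).2.1.sameFace.trans h₃⟩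
    | false =>
      obtain ⟨z, t, h₁, h₂, h₃⟩ := left i hi.le
      exact ⟨z, t, h₁, h₂, (hs.of_false i hi hsi).2.2.sameFace.trans h₃⟩

/-- The cycle runs along the rail `true` to the right and along the rail `false` to the left. -/
theorem IsHalin.exists_rimStep_rails [Finite V] (H : IsHalin G T C) (h : IsComb T n w l) :
    ∃ s, (∀ j ≤ n, OnStrand n s (some true) j → ∃ k, StrandEdge n s (some true) j k ∧
        RimStep C (place w l (node n (some true) j)) (place w l (node n (some true) k))) ∧
      (∀ k, 1 ≤ k → k ≤ n + 1 → OnStrand n s (some false) k → ∃ j, StrandEdge n s (some false) j k ∧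
        RimStep C (place w l (node n (some false) k)) (place w l (node n (some false) j))) := by
  obtain ⟨R, hR, d₀, hd₀⟩ := H.plane
  obtain ⟨s, hs⟩ := H.exists_sides h R
  have hits := fun x y => H.exists_face_leaf h hs (x := x) (y := y)
  refine ⟨s, fun j hj hon => ?_, fun k hk₁ hk hon => ?_⟩
  · obtain ⟨k, hjk, hk, hon', hbet, t, ht, hf⟩ := H.exists_face_right h hs (n - j) j (by omega)
    refine ⟨k, ⟨hjk, hk, hon, hon', hbet⟩, ?_⟩
    have hz := h.deg_place (b := true) hk
    rcases Nat.eq_zero_or_pos j with rfl | hj0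
    · exact H.rimStep_of_sameFace hR hd₀ hits h.deg_zero hz (h.adj_succ (by omega)) ht hf
    · obtain ⟨j, rfl⟩ : ∃ i, j = i + 1 := ⟨j - 1, by omega⟩
      rw [node_of_inner _ hj0 hj]
      have hsj : s (j + 1) = true := by
        rcases hon with hon | hon | hon | hon
        · omega
        · omega
        · cases hon
        · exact (Option.some.inj hon).symm
      -- From the leaf the facial walk reaches the spine, turns towards `w (j + 2)` and follows the
      -- spine until the next vertex of this rail.
      exact H.rimStep_of_sameFace hR hd₀ hits (h.deg_leaf j hj) hz (h.adj_leaf hj).symm ht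
        ((hs.of_true j hj hsj).2.1.sameFace.trans hf)
  · obtain ⟨k, rfl⟩ : ∃ i, k = i + 1 := ⟨k - 1, by omega⟩
    rcases Nat.lt_or_ge k n with hkn | hkn
    · have hsk : s (k + 1) = false := by
        rcases hon with hon | hon | hon | hon
        · omega
        · omega
        · cases hon
        · exact (Option.some.inj hon).symm
      obtain ⟨j, hj, hon', hbet, t, ht, hf⟩ := H.exists_face_left h hs k hkn.le
      refine ⟨j, ⟨by omega, hk, hon', hon, hbet⟩, ?_⟩
      rw [node_of_inner _ hk₁ hkn]
      exact H.rimStep_of_sameFace hR hd₀ hits (h.deg_leaf k hkn) (h.deg_place (by omega))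
        (h.adj_leaf hkn).symm ht ((hs.of_false k hkn hsk).2.2.sameFace.trans hf)
    · obtain rfl : k = n := by omega
      obtain ⟨j, hj, hon', hbet, t, ht, hf⟩ := H.exists_face_left h hs k le_rfl
      refine ⟨j, ⟨by omega, hk, hon', hon, hbet⟩, ?_⟩
      have hn : place w l (node k (some false) (k + 1)) = w (k + 1) := by simp [node, place]
      rw [hn]
      exact H.rimStep_of_sameFace hR hd₀ hits h.deg_last (h.deg_place (by omega))
        (h.adj_succ le_rfl).symm ht hf

/-- The vertices of a cubic caterpillar Halin graph are placed on three strands. -/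
structure IsPlacement (G : SimpleGraph V) (n : ℕ) (s : ℕ → Bool) (f : V → Option Bool × ℕ) : Prop where
  injective : Function.Injective f
  valid : ∀ x, Valid n s (f x)
  surj : ∀ p, Valid n s p → ∃ x, f x = p
  link : ∀ x y, G.Adj x y → Link n s (f x) (f y) ∨ Link n s (f y) (f x)

theorem IsHalin.exists_placement [Finite V] (H : IsHalin G T C) (h : IsComb T n w l) :
    ∃ s f, IsPlacement G n s f := by
  obtain ⟨s, hright, hleft⟩ := H.exists_rimStep_rails h
  have hplace : ∀ x, ∃ p, Valid n s p ∧ place w l p = x := by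
    intro x
    rcases h.cover x with ⟨i, hi, rfl⟩ | ⟨i, hi, rfl⟩
    · exact ⟨(none, i), .inl ⟨rfl, hi⟩, rfl⟩
    · exact ⟨(some (s (i + 1)), i + 1), .inr ⟨rfl, by simp, hi⟩, rfl⟩
  choose f hf hf' using hplace
  have hfp : ∀ p, Valid n s p → f (place w l p) = p := fun p hp =>
    h.place_injOn (hf _) hp (hf' _)
  have link : ∀ {p q}, Link n s p q → Link n s (f (place w l p)) (f (place w l q)) := by
    intro p q hpq
    rwa [hfp p hpq.valid.1, hfp q hpq.valid.2]
  have spine : ∀ i ≤ n, Link n s (none, i) (none, i + 1) := by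
    intro i hi
    have := Link.strand (s := s) none i (i + 1) ⟨by omega, by omega, .inr (.inr (.inl rfl)),
      .inr (.inr (.inl rfl)), by intros; omega⟩ (n := n)
    simpa [node] using this
  have rung : ∀ i < n, Link n s (none, i + 1) (some (s (i + 1)), i + 1) := fun i hi =>
    .rung _ (by omega) hi
  have rim : ∀ x y, RimStep C x y → Link n s (f x) (f y) ∨ Link n s (f y) (f x) := by
    intro x y hxy
    have fwd : ∀ j ≤ n, OnStrand n s (some true) j → place w l (node n (some true) j) = x →
        Link n s (f x) (f y) ∨ Link n s (f y) (f x) := by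
      rintro j hj hon rfl
      obtain ⟨k, hk, hr⟩ := hright j hj hon
      rw [H.rimStep_right_unique hxy hr]
      exact .inl (link (.strand _ _ _ hk))
    have bwd : ∀ k, 1 ≤ k → k ≤ n + 1 → OnStrand n s (some false) k →
        place w l (node n (some false) k) = x → Link n s (f x) (f y) ∨ Link n s (f y) (f x) := by
      rintro k hk₁ hk hon rfl
      obtain ⟨j, hj, hr⟩ := hleft k hk₁ hk hon
      rw [H.rimStep_right_unique hxy hr]
      exact .inr (link (.strand _ _ _ hj))
    have hx := (H.rimStep_leaf hxy).1
    rcases h.cover x with ⟨i, hi, rfl⟩ | ⟨i, hi, rfl⟩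
    · rcases Nat.eq_zero_or_pos i with rfl | hi0
      · exact fwd 0 (by omega) (.inl rfl) (by simp [node, place])
      · rcases Nat.lt_or_ge n i with hin | hin
        · obtain rfl : i = n + 1 := by omega
          exact bwd (n + 1) (by omega) le_rfl (.inr (.inl rfl)) (by simp [node, place])
        · obtain ⟨i, rfl⟩ : ∃ k, i = k + 1 := ⟨i - 1, by omega⟩
          exact absurd hx (h.deg_inner i hin)
    · cases hsi : s (i + 1) with
      | true =>
        exact fwd (i + 1) hi (.inr (.inr (.inr (by rw [hsi]))))
          (by rw [node_of_inner _ (by omega) hi]; rfl)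
      | false =>
        exact bwd (i + 1) (by omega) (by omega) (.inr (.inr (.inr (by rw [hsi]))))
          (by rw [node_of_inner _ (by omega) hi]; rfl)
  refine ⟨s, f, fun x y hxy => by rw [← hf' x, ← hf' y, hxy], hf, fun p hp => ⟨_, hfp p hp⟩, ?_⟩
  intro x y hxy
  rcases H.adj_iff.1 hxy with hT | hr | hr
  · rcases h.adj_cases (fun _ _ => H.not_adj_of_leaf) hT with
      ⟨i, hi, rfl, rfl⟩ | ⟨i, hi, rfl, rfl⟩ | ⟨i, hi, rfl, rfl⟩ | ⟨i, hi, rfl, rfl⟩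
    · exact .inl (link (spine i hi))
    · exact .inr (link (spine i hi))
    · exact .inl (link (rung i hi))
    · exact .inr (link (rung i hi))
  · exact rim x y hr
  · exact (rim y x hr).symm

theorem IsHalin.isCubic (H : IsHalin G T C) (h : IsComb T n w l) : IsCubic G := by
  intro v
  have leaf : deg T v = 1 → ∃ x y z, x ≠ y ∧ x ≠ z ∧ y ≠ z ∧ ∀ u, G.Adj v u ↔ u = x ∨ u = y ∨ u = z := by
    intro hv
    obtain ⟨x, hx⟩ := H.exists_rimStep_left hv
    obtain ⟨y, hy⟩ := H.exists_rimStep_right hv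
    obtain ⟨t, ht⟩ := exists_adj_of_deg_eq_one hv
    exact ⟨x, y, t, H.adj_leaf_iff hx hy ht⟩
  rcases h.cover v with ⟨i, hi, rfl⟩ | ⟨i, hi, rfl⟩
  · by_cases hin : 1 ≤ i ∧ i ≤ n
    · obtain ⟨i, rfl⟩ : ∃ k, i = k + 1 := ⟨i - 1, by omega⟩
      obtain ⟨h₁, h₂, h₃⟩ := h.ne i hin.2
      exact ⟨_, _, _, h₁, h₂, h₃, H.adj_inner_iff h hin.2⟩
    · apply leaf
      obtain rfl | rfl : i = 0 ∨ i = n + 1 := by omega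
      exacts [h.deg_zero, h.deg_last]
  · exact leaf (h.deg_leaf i hi)

/-- The leaf of the first rung is the first vertex after the pole on its rail, so the cycle joins it
to the pole `w 0`. -/
theorem IsHalin.exists_triangle [Finite V] (H : IsHalin G T C) (h : IsComb T n w l) :
    G.Adj (w 1) (w 0) ∧ G.Adj (w 1) (l 1) ∧ G.Adj (w 0) (l 1) := by
  obtain ⟨s, hright, hleft⟩ := H.exists_rimStep_rails h
  have hn := h.pos
  refine ⟨H.adj_iff.2 (.inl (h.adj_prev hn)), H.adj_iff.2 (.inl (h.adj_leaf hn)), ?_⟩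
  have h₀ : ∀ b, place w l (node n (some b) 0) = w 0 := by simp [node, place]
  have h₁ : ∀ b, place w l (node n (some b) 1) = l 1 := by
    intro b; rw [node_of_inner _ le_rfl hn]; rfl
  cases hs : s 1 with
  | true =>
    obtain ⟨k, hk, hr⟩ := hright 0 (by omega) (.inl rfl)
    obtain rfl : k = 1 := hk.right_unique
      ⟨by omega, by omega, .inl rfl, .inr (.inr (.inr (by rw [hs]))), by intros; omega⟩
    rw [h₀, h₁] at hr
    exact hr.1
  | false =>
    have hon : OnStrand n s (some false) 1 := .inr (.inr (.inr (by rw [hs])))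
    obtain ⟨j, hj, hr⟩ := hleft 1 le_rfl (by omega) hon
    obtain rfl : j = 0 := hj.left_unique ⟨by omega, by omega, .inl rfl, hon, by intros; omega⟩
    rw [h₀, h₁] at hr
    exact hr.1.symm

end Halin

end HalinStar

/-! ### Two rungs: the excluded prism -/

namespace HalinStar
variable {V : Type*}

/-- A bijective homomorphism between cubic graphs is an isomorphism. -/
theorem IsCubic.nonempty_iso {W : Type*} {G : SimpleGraph V} {K : SimpleGraph W} (hG : IsCubic G)
    (hK : IsCubic K) {φ : V → W} (hφ : Function.Bijective φ)
    (hadj : ∀ x y, G.Adj x y → K.Adj (φ x) (φ y)) : Nonempty (G ≃g K) := by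
  refine ⟨Equiv.ofBijective φ hφ, ?_⟩
  intro x y
  refine ⟨fun hxy => ?_, hadj x y⟩
  change K.Adj (φ x) (φ y) at hxy
  obtain ⟨a, b, c, hab, hac, hbc, h⟩ := hG x
  obtain ⟨p, q, r, hpq, hpr, hqr, h'⟩ := hK (φ x)
  have ha := (h' _).1 (hadj x a ((h a).2 (by simp)))
  have hb := (h' _).1 (hadj x b ((h b).2 (by simp)))
  have hc := (h' _).1 (hadj x c ((h c).2 (by simp)))
  have hab' := hφ.1.ne hab
  have hac' := hφ.1.ne hac
  have hbc' := hφ.1.ne hbc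
  have hy := (h' _).1 hxy
  -- The images of the three neighbors of `x` are distinct neighbors of `φ x`, so they exhaust them.
  have : φ y = φ a ∨ φ y = φ b ∨ φ y = φ c := by grind
  rw [h]
  rcases this with h | h | h
  exacts [.inl (hφ.1 h), .inr (.inl (hφ.1 h)), .inr (.inr (hφ.1 h))]

instance (h : ℕ) : DecidableRel (necklace h).Adj := fun x y => by
  unfold necklace
  rw [SimpleGraph.fromRel_adj]
  rcases x with i | i <;> rcases y with j | j <;> infer_instance

theorem isCubic_necklace_two : IsCubic (necklace 2) := by
  unfold IsCubic
  decide +kernel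

/-- The triangular prism as three strands joined by two rungs, which lie on the same side or not. -/
def prismMap (same : Bool) : Option Bool × ℕ → Fin 2 ⊕ Fin 4
  | (none, 0) => .inr 0
  | (none, 1) => .inl 0
  | (none, 2) => .inl 1
  | (none, _) => if same then .inr 3 else .inr 2
  | (some _, 1) => .inr 1
  | (some _, _) => if same then .inr 2 else .inr 3

/-- The right pole and the second leaf are adjacent to each other and to `v₂`. Which of them is
joined to the first leaf, and so must become `u₂`, depends on whether the two rungs share a side. -/
theorem prismMap_adj {s : ℕ → Bool} {p q : Option Bool × ℕ} (h : Link 2 s p q) :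
    (necklace 2).Adj (prismMap (s 1 == s 2) p) (prismMap (s 1 == s 2) q) := by
  rcases h with ⟨σ, j, k, h⟩ | ⟨i, h₁, h₂⟩
  · obtain ⟨hlt, hle, hl, hr, hb⟩ := h
    have b₁ := hb 1
    have b₂ := hb 2
    unfold OnStrand at hl hr b₁ b₂
    interval_cases k <;> interval_cases j <;> rcases σ with _ | _ | _ <;> cases hs₁ : s 1 <;>
      cases hs₂ : s 2 <;> simp_all [node] <;> decide +kernel
  · interval_cases i <;> cases s 1 <;> cases s 2 <;> decide +kernel

theorem prismMap_inj (a b : Bool) {p q : Option Bool × ℕ}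
    (hp : p = (none, 0) ∨ p = (none, 1) ∨ p = (none, 2) ∨ p = (none, 3) ∨ p = (some a, 1) ∨
      p = (some b, 2))
    (hq : q = (none, 0) ∨ q = (none, 1) ∨ q = (none, 2) ∨ q = (none, 3) ∨ q = (some a, 1) ∨
      q = (some b, 2)) :
    prismMap (a == b) p = prismMap (a == b) q → p = q := by
  rcases hp with rfl | rfl | rfl | rfl | rfl | rfl <;>
    rcases hq with rfl | rfl | rfl | rfl | rfl | rfl <;> revert a b <;> decide +kernel

theorem IsPlacement.nonempty_iso_necklace {G : SimpleGraph V} {s : ℕ → Bool}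
    {f : V → Option Bool × ℕ} (h : IsPlacement G 2 s f) (hG : IsCubic G) :
    Nonempty (G ≃g necklace 2) := by
  have valid : ∀ p, Valid 2 s p → p = (none, 0) ∨ p = (none, 1) ∨ p = (none, 2) ∨ p = (none, 3) ∨
      p = (some (s 1), 1) ∨ p = (some (s 2), 2) := by
    rintro ⟨σ, i⟩ (⟨h₁, h₂⟩ | ⟨h₁, h₂, h₃⟩) <;> simp only at *
    · subst h₁
      interval_cases i <;> simp
    · subst h₁
      interval_cases i <;> simp
  have v₀ : ∀ i ≤ 3, Valid 2 s (none, i) := fun i hi => .inl ⟨rfl, hi⟩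
  have v₁ : Valid 2 s (some (s 1), 1) := .inr ⟨rfl, by simp, by simp⟩
  have v₂ : Valid 2 s (some (s 2), 2) := .inr ⟨rfl, by simp, by simp⟩
  refine hG.nonempty_iso isCubic_necklace_two (φ := fun x => prismMap (s 1 == s 2) (f x))
    ⟨fun x y hxy => h.injective ?_, fun z => ?_⟩ ?_
  · exact prismMap_inj _ _ (valid _ (h.valid x)) (valid _ (h.valid y)) hxy
  · have key : ∃ p, Valid 2 s p ∧ prismMap (s 1 == s 2) p = z := by
      have : ∀ (a b : Bool) (z : Fin 2 ⊕ Fin 4), prismMap (a == b) (none, 0) = z ∨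
          prismMap (a == b) (none, 1) = z ∨ prismMap (a == b) (none, 2) = z ∨
          prismMap (a == b) (none, 3) = z ∨ prismMap (a == b) (some a, 1) = z ∨
          prismMap (a == b) (some b, 2) = z := by decide +kernel
      rcases this (s 1) (s 2) z with h | h | h | h | h | h
      exacts [⟨_, v₀ _ (by simp), h⟩, ⟨_, v₀ _ (by simp), h⟩, ⟨_, v₀ _ (by simp), h⟩,
        ⟨_, v₀ _ (by simp), h⟩, ⟨_, v₁, h⟩, ⟨_, v₂, h⟩]
    obtain ⟨p, hp, hz⟩ := key
    obtain ⟨x, rfl⟩ := h.surj p hp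
    exact ⟨x, hz⟩
  · intro x y hxy
    rcases h.link x y hxy with h | h
    exacts [prismMap_adj h, (prismMap_adj h).symm]

end HalinStar

/-! ### The main theorem -/

theorem theorem4p1 {V : Type*} [Finite V] (h : ℕ) (G : SimpleGraph V)
    (hG : HalinStar.CaterpillarHalin h G)
    (hne : ¬ Nonempty (G ≃g HalinStar.necklace 2)) :
    HalinStar.starChromaticIndex G = 5 := by
  obtain ⟨T, r, C, H, hT, -⟩ := hG
  obtain ⟨n, w, l, hcomb⟩ := H.exists_comb hT
  have hcubic := H.isHalin.isCubic hcomb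
  obtain ⟨s, f, hf⟩ := H.isHalin.exists_placement hcomb
  have hn : n = 1 ∨ 3 ≤ n := by
    have h₁ := hcomb.pos
    have h₂ : n ≠ 2 := by
      rintro rfl
      exact hne (hf.nonempty_iso_necklace hcubic)
    omega
  have h5 := HalinStar.starEdgeColorable_five_of_link hn f hf.injective hf.link
  obtain ⟨h₁, h₂, h₃⟩ := H.isHalin.exists_triangle hcomb
  refine le_antisymm (Nat.sInf_le h5) (le_csInf ⟨5, h5⟩ fun k hk => ?_)
  by_contra hlt
  exact HalinStar.not_starEdgeColorable_of_triangle hcubic h₁ h₂ h₃ (by omega) hk
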